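/- **Setting.** Let $\Lambda$ be a finite-dimensional smooth manifold and let $\pi\colon\mathcal G\to\Lambda$ be a smooth bundle of (finite-dimensional) Lie groups, i.e. a Lie groupoid over $\Lambda$ whose source and target maps both equal the smooth submersion $\pi$, with smooth composition on $\mathcal G\times_\Lambda\mathcal G$, smooth inversion and smooth unit section $\lambda\mapsto 1_\lambda$. Write $G_\lambda=\pi^{-1}(\lambda)$ for the fibre groups, $\mathfrak g_\lambda=\ker \mathrm d\pi(1_\lambda)$ for their Lie algebras and $\mathrm{Lie}(\mathcal G)=\bigcup_\lambda\mathfrak g_\lambda$. Let $X$ be a (Hausdorff, smooth) Banach manifold on which $\mathcal G$ acts by diffeomorphisms: every $G_\lambda$ acts on $X$, each of its elements acting as a diffeomorphism. Assume that the action is *regular*: for all $\lambda\in\Lambda$, $x\in X$ the map $\beta_x^\lambda\colon G_\lambda\to X$, $\beta_x^\lambda(g)=g\cdot x$, is differentiable at $1_\lambda$, and $(\lambda,x)\mapsto \mathrm d\beta_x^\lambda(1_\lambda)$ is a continuous section of $\mathrm{Hom}(\mathrm{Lie}(\mathcal G),TX)$ over $\Lambda\times X$. Let $\mathcal D_x^\lambda\subset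 T_xX$ be the image of $\mathrm d\beta_x^\lambda(1_\lambda)$. Let $k\ge 1$ and let $f_\lambda\colon X\to\mathbb R$, $\lambda\in\Lambda$, be functions of class $C^{k+1}$ with $f_\lambda(g\cdot x)=f_\lambda(x)$ for all $x\in X$, $g\in G_\lambda$. Assume that there are * a smooth Banach bundle $\mathcal E$ over $X$ with a continuous inclusion $TX\subset\mathcal E$; * a (possibly non-complete) inner product $\langle\cdot,\cdot\rangle_x$ on each fibre $\mathcal E_x$, such that the pairing $(e,w)\mapsto\langle e,w\rangle_x$, $e\in\mathcal E_x$, $w\in T_xX$, is continuous on the fibrewise product $\mathcal E\times_X TX$; * sections $\delta f_\lambda\colon X\to\mathcal E$, of class $C^k$ jointly in $(\lambda,x)\in\Lambda\times X$, with $\mathrm df_\lambda(x)=\langle\delta f_\lambda(x),\cdot\rangle_x$ on $T_xX$, and such that $\mathrm df_\lambda(x)=0$ if and only if $\delta f_\lambda(x)=0$. **Theorem.** Let $x_0\in X$ be an equivariantly nondegenerate critical point of $f_{\lambda_0}$, i.e. $\mathrm df_{\lambda_0}(x_0)=0$ and $\ker \mathrm d^2 f_{\lambda_0}(x_0)\subset\mathcal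 D_{x_0}^{\lambda_0}$ (the opposite inclusion is automatic). Assume that there is a Fredholm operator $J\colon T_{x_0}X\to\mathcal E_{x_0}$ of index $0$ with $\mathrm d^2 f_{\lambda_0}(x_0)[v,w]=\langle Jv,w\rangle_{x_0}$ for all $v,w\in T_{x_0}X$. Then there exist an open neighbourhood $U\subset\Lambda$ of $\lambda_0$, an open neighbourhood $V\subset X$ of $x_0$ and a map $U\ni\lambda\mapsto x_\lambda\in V$ such that, for all $(\lambda,x)\in U\times V$, one has $\mathrm df_\lambda(x)=0$ if and only if $x$ belongs to the $G_\lambda$-orbit of $x_\lambda$. -/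

import Mathlib

open Set Manifold Bundle
open scoped ContDiff Manifold Topology Bundle

noncomputable section

namespace EquivariantIFT

/-! ### Bundles of Lie groups -/

section BundleOfGroups

variable (EΛ : Type*) [NormedAddCommGroup EΛ] [NormedSpace ℝ EΛ]
  (Λ : Type*) [TopologicalSpace Λ] [ChartedSpace EΛ Λ]
  (EG : Type*) [NormedAddCommGroup EG] [NormedSpace ℝ EG]
  (𝒢 : Type*) [TopologicalSpace 𝒢] [ChartedSpace EG 𝒢]

/-- A smooth bundle of Lie groups over the manifold `Λ`: a Lie groupoid with total space `𝒢` whose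
source and target maps coincide; their common value is `proj`. The composition `mul g h` is
meaningful only if `proj g = proj h`, and it is smooth on the fibred product `𝒢 ×_Λ 𝒢`, a
submanifold of `𝒢 × 𝒢`. The group over `l` is the fibre `proj ⁻¹' {l}`, with unit `one l`. -/
structure LieGroupBundle where
  proj : 𝒢 → Λ
  mul : 𝒢 → 𝒢 → 𝒢
  inv : 𝒢 → 𝒢
  one : Λ → 𝒢
  proj_mul : ∀ g h, proj g = proj h → proj (mul g h) = proj g
  proj_inv : ∀ g, proj (inv g) = proj g
  proj_one : ∀ l, proj (one l) = l
  mul_assoc : ∀ g h k, proj g = proj h → proj h = proj k → mul (mul g h) k = mul g (mul h k)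
  one_mul : ∀ g, mul (one (proj g)) g = g
  mul_one : ∀ g, mul g (one (proj g)) = g
  inv_mul : ∀ g, mul (inv g) g = one (proj g)
  mul_inv : ∀ g, mul g (inv g) = one (proj g)
  isSubmersion_proj : IsSubmersion 𝓘(ℝ, EG) 𝓘(ℝ, EΛ) ∞ proj
  contMDiffOn_mul : ContMDiffOn (𝓘(ℝ, EG).prod 𝓘(ℝ, EG)) 𝓘(ℝ, EG) ∞
    (fun p : 𝒢 × 𝒢 => mul p.1 p.2) {p | proj p.1 = proj p.2}
  contMDiff_inv : ContMDiff 𝓘(ℝ, EG) 𝓘(ℝ, EG) ∞ inv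
  contMDiff_one : ContMDiff 𝓘(ℝ, EΛ) 𝓘(ℝ, EG) ∞ one

end BundleOfGroups

section Action

variable {EΛ : Type*} [NormedAddCommGroup EΛ] [NormedSpace ℝ EΛ]
  {Λ : Type*} [TopologicalSpace Λ] [ChartedSpace EΛ Λ]
  {EG : Type*} [NormedAddCommGroup EG] [NormedSpace ℝ EG]
  {𝒢 : Type*} [TopologicalSpace 𝒢] [ChartedSpace EG 𝒢]

namespace LieGroupBundle

/-- The group `G_l` over `l`. -/
def fiber (B : LieGroupBundle EΛ Λ EG 𝒢) (l : Λ) : Set 𝒢 := B.proj ⁻¹' {l}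

/-- The Lie algebra of `G_l`: the vertical tangent space `ker dπ` at the unit of `G_l`. -/
def lieAlg (B : LieGroupBundle EΛ Λ EG 𝒢) (l : Λ) :
    Submodule ℝ (TangentSpace 𝓘(ℝ, EG) (B.one l)) :=
  LinearMap.ker (mfderiv 𝓘(ℝ, EG) 𝓘(ℝ, EΛ) B.proj (B.one l)).toLinearMap

/-- The total space of the bundle of Lie algebras, as a subset of the tangent bundle of the total
space (from which it takes its topology): the vertical tangent vectors at units. -/
def lieBundle (B : LieGroupBundle EΛ Λ EG 𝒢) : Set (TangentBundle 𝓘(ℝ, EG) 𝒢) :=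
  {v | v.proj = B.one (B.proj v.proj) ∧
    mfderiv 𝓘(ℝ, EG) 𝓘(ℝ, EΛ) B.proj v.proj v.snd = 0}

end LieGroupBundle

variable {E : Type*} [NormedAddCommGroup E] [NormedSpace ℝ E]

/-- An action of a bundle of Lie groups on `X` by diffeomorphisms: for each `l`, an action of the
group `G_l` on `X`, each element of which acts by a diffeomorphism. -/
structure Action (B : LieGroupBundle EΛ Λ EG 𝒢) (E : Type*) [NormedAddCommGroup E]
    [NormedSpace ℝ E] (X : Type*) [TopologicalSpace X] [ChartedSpace E X] where
  act : 𝒢 → X → X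
  one_act : ∀ l x, act (B.one l) x = x
  mul_act : ∀ g h x, B.proj g = B.proj h → act (B.mul g h) x = act g (act h x)
  contMDiff_act : ∀ g, ContMDiff 𝓘(ℝ, E) 𝓘(ℝ, E) ∞ (act g)

namespace Action

variable {X : Type*} [TopologicalSpace X] [ChartedSpace E X] {B : LieGroupBundle EΛ Λ EG 𝒢}

/-- The orbit of `x` under the group `G_l`. -/
def orbit (A : Action B E X) (l : Λ) (x : X) : Set X := (fun g => A.act g x) '' B.fiber l

/-- A derivative at the unit, along the fibre `G_l`, of the orbit map `g ↦ g · x`. Off the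
Lie algebra `B.lieAlg l` (the tangent space of the fibre) its values are irrelevant;
on `B.lieAlg l` it is the differential of the orbit map `G_l → X`. -/
def orbitDeriv (A : Action B E X) (l : Λ) (x : X) :
    TangentSpace 𝓘(ℝ, EG) (B.one l) →L[ℝ] TangentSpace 𝓘(ℝ, E) x :=
  (mfderivWithin 𝓘(ℝ, EG) 𝓘(ℝ, E) (fun g => A.act g x) (B.fiber l) (B.one l) : EG →L[ℝ] E)

/-- The image of the differential at the unit of the orbit map `G_l → X`, `g ↦ g · x`. -/
def orbitTangent (A : Action B E X) (l : Λ) (x : X) : Submodule ℝ (TangentSpace 𝓘(ℝ, E) x) :=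
  (B.lieAlg l).map (A.orbitDeriv l x).toLinearMap

/-- The action is regular: every orbit map `G_l → X` is differentiable at the unit, and its
differential there depends continuously on `(l, x)`, as a section of `Hom(Lie 𝒢, TX)` over `Λ × X`.
Since `Lie 𝒢` has finite rank, this is continuity of the induced map
`Lie 𝒢 × X → TX`, `((l, v), x) ↦ dβ_x^l(1) v`. -/
structure IsRegular [IsManifold 𝓘(ℝ, EG) ∞ 𝒢] [IsManifold 𝓘(ℝ, E) ∞ X] (A : Action B E X) :
    Prop where
  mdifferentiable : ∀ l x, MDifferentiableWithinAt 𝓘(ℝ, EG) 𝓘(ℝ, E) (fun g => A.act g x)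
    (B.fiber l) (B.one l)
  continuous_deriv : Continuous (fun p : B.lieBundle × X =>
    (⟨p.2, A.orbitDeriv (B.proj p.1.1.proj) p.2 p.1.1.snd⟩ : TangentBundle 𝓘(ℝ, E) X))

end Action

end Action

/-! ### Critical points and Hessians -/

section Functional

variable {E : Type*} [NormedAddCommGroup E] [NormedSpace ℝ E]
  {X : Type*} [TopologicalSpace X] [ChartedSpace E X]

/-- `x` is a critical point of `f`. -/
def IsCritical (E : Type*) [NormedAddCommGroup E] [NormedSpace ℝ E]
    {X : Type*} [TopologicalSpace X] [ChartedSpace E X] (f : X → ℝ) (x : X) : Prop :=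
  mfderiv 𝓘(ℝ, E) 𝓘(ℝ) f x = 0

/-- The second derivative of `f` at `x` in the preferred chart at `x` (the one that identifies
`T_x X` with the model space). At a critical point of a `C^2` function this is the Hessian
of `f`, independently of charts. -/
def hessian (f : X → ℝ) (x : X) :
    TangentSpace 𝓘(ℝ, E) x →L[ℝ] TangentSpace 𝓘(ℝ, E) x →L[ℝ] ℝ :=
  (fderiv ℝ (fderiv ℝ (f ∘ (extChartAt 𝓘(ℝ, E) x).symm)) (extChartAt 𝓘(ℝ, E) x x) :
    E →L[ℝ] E →L[ℝ] ℝ)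

end Functional

section Equivariant

variable {EΛ : Type*} [NormedAddCommGroup EΛ] [NormedSpace ℝ EΛ]
  {Λ : Type*} [TopologicalSpace Λ] [ChartedSpace EΛ Λ]
  {EG : Type*} [NormedAddCommGroup EG] [NormedSpace ℝ EG]
  {𝒢 : Type*} [TopologicalSpace 𝒢] [ChartedSpace EG 𝒢]
  {E : Type*} [NormedAddCommGroup E] [NormedSpace ℝ E]
  {X : Type*} [TopologicalSpace X] [ChartedSpace E X] {B : LieGroupBundle EΛ Λ EG 𝒢}

/-- The family `f` is invariant: `f_l (g · x) = f_l x` for `g ∈ G_l`. -/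
def Action.Invariant (A : Action B E X) (f : Λ → X → ℝ) : Prop :=
  ∀ l, ∀ g ∈ B.fiber l, ∀ x, f l (A.act g x) = f l x

/-- `x` is an equivariantly nondegenerate critical point of `f_l`: it is critical, and the kernel of
the Hessian is contained in the image of the differential of the orbit map (the opposite
inclusion is automatic). -/
def Action.EquivariantlyNondegenerate (A : Action B E X) (f : Λ → X → ℝ) (l : Λ) (x : X) : Prop :=
  IsCritical E (f l) x ∧ LinearMap.ker (hessian (E := E) (f l) x).toLinearMap ≤ A.orbitTangent l x

end Equivariant

/-! ### Auxiliary Fredholm structures -/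

section Fredholm

/-- The data underlying an auxiliary Fredholm structure for the family of functionals `f` on `X`:
a smooth Banach bundle `V` over `X` containing `TX`, an inner product on its fibres
(not necessarily complete), and gradient-like sections `grad l` of `V` representing `d f_l`,
of class `C^k` in `(l, x)`. -/
structure AuxiliaryStructure (k : ℕ)
    (EΛ : Type*) [NormedAddCommGroup EΛ] [NormedSpace ℝ EΛ]
    {Λ : Type*} [TopologicalSpace Λ] [ChartedSpace EΛ Λ]
    (E : Type*) [NormedAddCommGroup E] [NormedSpace ℝ E]
    {X : Type*} [TopologicalSpace X] [ChartedSpace E X] [IsManifold 𝓘(ℝ, E) ∞ X]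
    (f : Λ → X → ℝ)
    (F : Type*) [NormedAddCommGroup F] [NormedSpace ℝ F]
    (V : X → Type*) [∀ x, AddCommGroup (V x)] [∀ x, Module ℝ (V x)] [∀ x, TopologicalSpace (V x)]
    [TopologicalSpace (TotalSpace F V)] [FiberBundle F V] [VectorBundle ℝ F V]
    [ContMDiffVectorBundle ∞ F V 𝓘(ℝ, E)] where
  /-- the inclusion of `TX` in `V` -/
  incl : ∀ x, TangentSpace 𝓘(ℝ, E) x →L[ℝ] V x
  incl_injective : ∀ x, Function.Injective (incl x)
  continuous_incl : Continuous (fun v : TangentBundle 𝓘(ℝ, E) X =>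
    (⟨v.proj, incl v.proj v.snd⟩ : TotalSpace F V))
  inner : ∀ x, V x →ₗ[ℝ] V x →ₗ[ℝ] ℝ
  inner_symm : ∀ x u v, inner x u v = inner x v u
  inner_pos : ∀ x v, v ≠ 0 → 0 < inner x v v
  /-- the map `V → T^*X` induced by the inner product is continuous: the pairing
  `(e, w) ↦ ⟨e, w⟩_x` of `V` with `TX` is continuous on the fibrewise product of the bundles -/
  continuous_pairing : Continuous
    (fun p : TotalSpace (F × E) (V ×ᵇ (TangentSpace 𝓘(ℝ, E) : X → Type _)) =>
      inner p.proj p.snd.1 (incl p.proj p.snd.2))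
  grad : Λ → ∀ x, V x
  contMDiff_grad : ContMDiff (𝓘(ℝ, EΛ).prod 𝓘(ℝ, E)) (𝓘(ℝ, E).prod 𝓘(ℝ, F)) k
    (fun p : Λ × X => (⟨p.2, grad p.1 p.2⟩ : TotalSpace F V))
  mfderiv_eq : ∀ l x (w : TangentSpace 𝓘(ℝ, E) x),
    mfderiv 𝓘(ℝ, E) 𝓘(ℝ) (f l) x w = inner x (grad l x) (incl x w)
  isCritical_iff : ∀ l x, IsCritical E (f l) x ↔ grad l x = 0

variable {EΛ : Type*} [NormedAddCommGroup EΛ] [NormedSpace ℝ EΛ]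
    {Λ : Type*} [TopologicalSpace Λ] [ChartedSpace EΛ Λ]
    {E : Type*} [NormedAddCommGroup E] [NormedSpace ℝ E]
    {X : Type*} [TopologicalSpace X] [ChartedSpace E X] [IsManifold 𝓘(ℝ, E) ∞ X]
    {f : Λ → X → ℝ} {k : ℕ}
    {F : Type*} [NormedAddCommGroup F] [NormedSpace ℝ F]
    {V : X → Type*} [∀ x, AddCommGroup (V x)] [∀ x, Module ℝ (V x)] [∀ x, TopologicalSpace (V x)]
    [TopologicalSpace (TotalSpace F V)] [FiberBundle F V] [VectorBundle ℝ F V]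
    [ContMDiffVectorBundle ∞ F V 𝓘(ℝ, E)]

/-- The Hessian of `f_l` at `x` is represented by a Fredholm operator `J : T_x X → V_x` of index
`0`: `Hess(v, w) = ⟨J v, w⟩_x`. -/
def AuxiliaryStructure.HessianIsFredholm (S : AuxiliaryStructure k EΛ E f F V) (l : Λ) (x : X) :
    Prop :=
  ∃ J : TangentSpace 𝓘(ℝ, E) x →L[ℝ] V x, J.IsFredholm ∧
    Module.finrank ℝ (LinearMap.ker J.toLinearMap) =
      Module.finrank ℝ (V x ⧸ LinearMap.range J.toLinearMap) ∧
    ∀ v w : TangentSpace 𝓘(ℝ, E) x,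
      hessian (E := E) (f l) x v w = S.inner x (J v) (S.incl x w)

end Fredholm

end EquivariantIFT

end

namespace EquivariantIFT

/-! ### Paths and families of curves in a chart -/

section Chart

variable {E : Type*} [NormedAddCommGroup E] [NormedSpace ℝ E] [CompleteSpace E]
  {X : Type*} [TopologicalSpace X] [T2Space X]

/-! Fix a chart at `x₀`, let `K` be the kernel of `J`, and let `P` be a continuous projection of the
model space onto `K`. By equivariant nondegeneracy `K` consists of orbit directions, so the affine
slice `P (u - u₀) = 0` is transverse to the orbit of `x₀`. Two facts suffice: near `u₀` the slice
contains exactly one critical point for each nearby parameter, and every point near `x₀` is carried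
into the slice by a group element. Invariance of the critical set does the rest.

For the slice, let `σ` be the gradient in coordinates. Index zero, symmetry of the Hessian and
positivity of the inner product give `V_{x₀} = range J ⊕ incl K` (`isCompl_range_of_symmetric`).
Hence `σ + ι ∘ P (u - u₀)`, with `ι` the inclusion of `K` in the fibre of `V`, has invertible
derivative `J + ι P` in `u`, and the implicit function theorem gives its zeros as a graph
(`exists_zero_on_slice`). At such a zero `σ = ι κ` for some `κ` in `K`. By invariance `σ` is
orthogonal to the orbit velocity `Θ κ`, whereas `⟨ι κ, Θ κ⟩` is close to `⟨κ, κ⟩ > 0` for `κ ≠ 0`.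
So `κ = 0` and `σ = 0`: the solution is a genuine critical point.

For the motion into the slice, no joint continuity of the action is assumed. What regularity
provides is that the curves `w ↦ g a w · x` have a velocity depending continuously on `(a, w)` and
on the point reached. This bounds their speed as long as they stay in a chart ball, so short curves
cannot leave it (`path_mem_chart_ball`); their projections to `K` are then small perturbations of
the identity and take the value required by the slice (`eventually_exists_mem_slice`). -/

/-- A path in a Hausdorff space which, as long as it stays in a ball of a Banach chart, has speed at
most `C` there, does not leave the ball before it has had the time to do so. -/
theorem path_mem_chart_ball (φ : OpenPartialHomeomorph X E) {p : ℝ → X}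
    (hp : ContinuousOn p (Icc 0 1)) {u₀ : E} {ρ C : ℝ} (hC : 0 ≤ C) (h0 : p 0 ∈ φ.source)
    (hsmall : dist (φ (p 0)) u₀ + C < ρ) (hball : Metric.ball u₀ ρ ⊆ φ.target)
    (hder : ∀ t ∈ Icc (0 : ℝ) 1, p t ∈ φ.source → φ (p t) ∈ Metric.ball u₀ ρ →
      ∃ v, ‖v‖ ≤ C ∧ HasDerivWithinAt (fun s => φ (p s)) v (Icc 0 1) t) :
    ∀ t ∈ Icc (0 : ℝ) 1, p t ∈ φ.source ∧ φ (p t) ∈ Metric.ball u₀ ρ := by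
  set N : Set X := φ.source ∩ φ ⁻¹' Metric.ball u₀ ρ with hN
  have hNo : IsOpen N := φ.isOpen_inter_preimage Metric.isOpen_ball
  by_contra hcon
  push Not at hcon
  obtain ⟨t₁, ht₁, hbad⟩ := hcon
  have hclosed : IsClosed (Icc (0 : ℝ) 1 ∩ p ⁻¹' Nᶜ) :=
    hp.preimage_isClosed_of_isClosed isClosed_Icc hNo.isClosed_compl
  have hcomp : IsCompact (Icc (0 : ℝ) 1 ∩ p ⁻¹' Nᶜ) :=
    isCompact_Icc.of_isClosed_subset hclosed inter_subset_left
  -- `T` is the first time at which the path is outside the ball.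
  obtain ⟨T, ⟨hT, hTbad⟩, hTmin⟩ := hcomp.exists_isLeast
    ⟨t₁, ht₁, fun h => hbad h.1 h.2⟩
  have hgood : ∀ s ∈ Ico 0 T, p s ∈ N := by
    intro s hs
    by_contra hs'
    exact absurd (hTmin ⟨⟨hs.1, hs.2.le.trans hT.2⟩, hs'⟩) (not_le.mpr hs.2)
  have hN0 : p 0 ∈ N := ⟨h0, by rw [mem_preimage, Metric.mem_ball]; linarith⟩
  have hT0 : 0 < T := lt_of_le_of_ne hT.1 (by rintro rfl; exact hTbad hN0)
  have hsub : Ico 0 T ⊆ Icc (0 : ℝ) 1 := fun s hs => ⟨hs.1, hs.2.le.trans hT.2⟩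
  choose! v hv hv' using hder
  have hlip : LipschitzOnWith C.toNNReal (fun s => φ (p s)) (Ico 0 T) := by
    refine (convex_Ico 0 T).lipschitzOnWith_of_nnnorm_hasDerivWithin_le (f' := v) ?_ ?_
    · intro s hs
      exact (hv' s (hsub hs) (hgood s hs).1 (hgood s hs).2).mono hsub
    · intro s hs
      rw [← NNReal.coe_le_coe, coe_nnnorm, Real.coe_toNNReal C hC]
      exact hv s (hsub hs) (hgood s hs).1 (hgood s hs).2
  have hne : (𝓝[Ico 0 T] T).NeBot := by
    rw [← mem_closure_iff_nhdsWithin_neBot, closure_Ico hT0.ne]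
    exact ⟨hT0.le, le_rfl⟩
  have hcau : Cauchy (Filter.map (fun s => φ (p s)) (𝓝[Ico 0 T] T)) := by
    refine (Cauchy.mono (cauchy_nhds (a := T)) nhdsWithin_le_nhds).map_of_le
      hlip.uniformContinuousOn ?_
    exact Filter.le_principal_iff.mpr self_mem_nhdsWithin
  -- Completeness provides a limit in the chart as `s` increases to `T`. It lies within `C` of the
  -- starting point, hence in the ball. Since `X` is Hausdorff, the corresponding point of `X` must
  -- be `p T`, which therefore has not left the ball.
  obtain ⟨y, hy⟩ := CompleteSpace.complete hcau
  have hyt : Filter.Tendsto (fun s => φ (p s)) (𝓝[Ico 0 T] T) (𝓝 y) := hy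
  have hdist : dist y (φ (p 0)) ≤ C := by
    refine le_of_tendsto (hyt.dist tendsto_const_nhds) ?_
    filter_upwards [self_mem_nhdsWithin] with s hs
    have h1 := hlip.dist_le_mul s hs 0 ⟨le_rfl, hT0⟩
    rw [Real.coe_toNNReal C hC, Real.dist_eq, sub_zero, abs_of_nonneg hs.1] at h1
    nlinarith [(hsub hs).2]
  have hyb : y ∈ Metric.ball u₀ ρ := by
    rw [Metric.mem_ball]
    linarith [dist_triangle y (φ (p 0)) u₀]
  have hlim : Filter.Tendsto p (𝓝[Ico 0 T] T) (𝓝 (φ.symm y)) := by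
    refine (((φ.continuousAt_symm (hball hyb)).tendsto).comp hyt).congr' ?_
    filter_upwards [self_mem_nhdsWithin] with s hs using φ.left_inv (hgood s hs).1
  have hlim' : Filter.Tendsto p (𝓝[Ico 0 T] T) (𝓝 (p T)) := (hp T hT).mono hsub
  have heq := tendsto_nhds_unique hlim' hlim
  refine hTbad ?_
  rw [heq]
  refine ⟨φ.map_target (hball hyb), ?_⟩
  rw [mem_preimage, φ.right_inv (hball hyb)]
  exact hyb

/-- A family of curves `w ↦ q a w x` through the points `x` of a Banach manifold, with derivative
`Θ (a, w, u)` when they pass through the point of coordinate `u`, which is transverse to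
`{P (u - u₀) = 0}` at the point of coordinate `u₀`, meets this slice near that point. -/
theorem eventually_exists_mem_slice (φ : OpenPartialHomeomorph X E)
    {T : Type*} [TopologicalSpace T]
    {D : Type*} [NormedAddCommGroup D] [NormedSpace ℝ D] [CompleteSpace D]
    {q : T → D → X → X} {Θ : T × D × E → D →L[ℝ] E} {a₀ : T} {u₀ : E} (hu₀ : u₀ ∈ φ.target)
    (hΘ : ContinuousAt Θ (a₀, 0, u₀)) {P : E →L[ℝ] D}
    (hP : P ∘L Θ (a₀, 0, u₀) = ContinuousLinearMap.id ℝ D)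
    {N : Set (T × D)} (hN : N ∈ 𝓝 (a₀, 0)) (hq0 : ∀ a x, (a, (0 : D)) ∈ N → q a 0 x = x)
    (hcont : ∀ a w x, (a, w) ∈ N → ContinuousAt (fun w' => q a w' x) w)
    (hder : ∀ a w x, (a, w) ∈ N → q a w x ∈ φ.source →
      HasFDerivAt (fun w' => φ (q a w' x)) (Θ (a, w, φ (q a w x))) w)
    {O : Set E} (hO : O ∈ 𝓝 u₀) :
    ∀ᶠ z : T × E in 𝓝 (a₀, u₀), ∃ w, (z.1, w) ∈ N ∧ q z.1 w (φ.symm z.2) ∈ φ.source ∧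
      φ (q z.1 w (φ.symm z.2)) ∈ O ∧ P (φ (q z.1 w (φ.symm z.2)) - u₀) = 0 := by
  set Θ₀ := Θ (a₀, 0, u₀) with hΘ₀
  -- The bound `1` keeps `‖Θ‖` below `‖Θ₀‖ + 1`; the other bound keeps `P ∘ Θ` within `1 / 2` of `P
  -- ∘ Θ₀ = id`.
  set c : ℝ := min 1 (1 / (2 * (‖P‖ + 1))) with hc
  have hPpos : 0 < ‖P‖ + 1 := by positivity
  have hcpos : 0 < c := lt_min one_pos (by positivity)
  have h1 : ∀ᶠ z : T × D × E in 𝓝 (a₀, 0, u₀), dist (Θ z) Θ₀ < c :=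
    hΘ (Metric.ball_mem_nhds _ hcpos)
  have h2 : ∀ᶠ z : T × D × E in 𝓝 (a₀, 0, u₀), (z.1, z.2.1) ∈ N := by
    have : ContinuousAt (fun z : T × D × E => (z.1, z.2.1)) (a₀, 0, u₀) := by fun_prop
    exact this hN
  have h3 : ∀ᶠ z : T × D × E in 𝓝 (a₀, 0, u₀), z.2.2 ∈ O ∩ φ.target := by
    have : ContinuousAt (fun z : T × D × E => z.2.2) (a₀, 0, u₀) := by fun_prop
    exact this (Filter.inter_mem hO (φ.open_target.mem_nhds hu₀))
  have h4 := h1.and (h2.and h3)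
  rw [nhds_prod_eq, nhds_prod_eq] at h4
  obtain ⟨A, hA, Q, hQ, hAQ⟩ := Filter.mem_prod_iff.mp h4
  obtain ⟨R, hR, Q', hQ', hRQ⟩ := Filter.mem_prod_iff.mp hQ
  obtain ⟨r₀, hr₀, hr₀R⟩ := Metric.mem_nhds_iff.mp hR
  obtain ⟨ρ, hρ, hρQ⟩ := Metric.mem_nhds_iff.mp hQ'
  have key : ∀ a ∈ A, ∀ w ∈ Metric.ball (0 : D) r₀, ∀ u ∈ Metric.ball u₀ ρ,
      dist (Θ (a, w, u)) Θ₀ < c ∧ (a, w) ∈ N ∧ u ∈ O ∩ φ.target := fun a ha w hw u hu =>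
    hAQ (mk_mem_prod ha (hRQ (mk_mem_prod (hr₀R hw) (hρQ hu))))
  set C : ℝ := ‖Θ₀‖ + 1 with hCdef
  have hCpos : 0 < C := by positivity
  -- A curve with parameter of norm at most `r` has length at most `C * r ≤ ρ / 4`. Starting within
  -- `ρ / 2` of `u₀`, it stays in the ball of radius `ρ`.
  set r : ℝ := min (r₀ / 2) (ρ / (4 * C)) with hr
  have hrpos : 0 < r := lt_min (by positivity) (by positivity)
  have hrr₀ : r < r₀ := (min_le_left _ _).trans_lt (by linarith)
  have hCr : C * r ≤ ρ / 4 := by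
    calc C * r ≤ C * (ρ / (4 * C)) := by gcongr; exact min_le_right _ _
      _ = ρ / 4 := by field_simp
  have e1 : ∀ᶠ z : T × E in 𝓝 (a₀, u₀), z.1 ∈ A := continuousAt_fst hA
  -- The second bound gives `‖P (u - u₀)‖ ≤ r / 2`, the radius covered by the image of the ball of
  -- radius `r` under a `1 / 2`-perturbation of the identity.
  set δ : ℝ := min (ρ / 2) (r / (2 * (‖P‖ + 1))) with hδ
  have hδpos : 0 < δ := lt_min (by positivity) (by positivity)
  have e2 : ∀ᶠ z : T × E in 𝓝 (a₀, u₀), z.2 ∈ Metric.ball u₀ δ :=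
    continuousAt_snd (Metric.ball_mem_nhds _ hδpos)
  filter_upwards [e1, e2] with ⟨a, u⟩ ha hu
  simp only at ha hu ⊢
  have huρ : u ∈ Metric.ball u₀ ρ :=
    Metric.ball_subset_ball ((min_le_left _ _).trans (by linarith)) hu
  have hballt : Metric.ball u₀ ρ ⊆ φ.target := fun u' hu' =>
    (key a ha 0 (Metric.mem_ball_self hr₀) u' hu').2.2.2
  have hut : u ∈ φ.target := hballt huρ
  have hNw : ∀ w ∈ Metric.ball (0 : D) r₀, (a, w) ∈ N := fun w hw => (key a ha w hw u huρ).2.1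
  set x := φ.symm u with hx
  have hxs : x ∈ φ.source := φ.map_target hut
  have hq0x : q a 0 x = x := hq0 a x (hNw 0 (Metric.mem_ball_self hr₀))
  have hφx : φ x = u := φ.right_inv hut
  -- the curves stay in the chart
  have hstay : ∀ w ∈ Metric.closedBall (0 : D) r,
      q a w x ∈ φ.source ∧ φ (q a w x) ∈ Metric.ball u₀ ρ := by
    intro w hw
    have hw' : ‖w‖ ≤ r := by simpa using hw
    have htw : ∀ t ∈ Icc (0 : ℝ) 1, t • w ∈ Metric.ball (0 : D) r₀ := by
      intro t ht
      rw [mem_ball_zero_iff, norm_smul, Real.norm_of_nonneg ht.1]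
      nlinarith [ht.1, ht.2, norm_nonneg w]
    have := path_mem_chart_ball φ (p := fun t : ℝ => q a (t • w) x) (u₀ := u₀) (ρ := ρ)
      (C := C * r) ?_ (by positivity) ?_ ?_ hballt ?_ 1 ⟨zero_le_one, le_rfl⟩
    · simpa using this
    · intro t ht
      refine ContinuousAt.continuousWithinAt ?_
      exact ContinuousAt.comp (f := fun t : ℝ => t • w) (g := fun w' => q a w' x)
        (hcont a _ x (hNw _ (htw t ht))) (by fun_prop)
    · simpa [hq0x] using hxs
    · simp only [zero_smul, hq0x, hφx]
      have : dist u u₀ < ρ / 2 := (Metric.mem_ball.mp hu).trans_le (min_le_left _ _)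
      linarith
    · intro t ht hs hb
      refine ⟨Θ (a, t • w, φ (q a (t • w) x)) w, ?_, ?_⟩
      · have hk := (key a ha _ (htw t ht) _ hb).1
        rw [dist_eq_norm] at hk
        have hn : ‖Θ (a, t • w, φ (q a (t • w) x))‖ ≤ C := by
          have := norm_le_insert' (Θ (a, t • w, φ (q a (t • w) x))) Θ₀
          have hc1 : c ≤ 1 := min_le_left _ _
          linarith
        exact (ContinuousLinearMap.le_opNorm _ _).trans (by gcongr)
      · have hd := hder a (t • w) x (hNw _ (htw t ht)) hs
        have hl : HasDerivAt (fun t : ℝ => t • w) w t := by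
          simpa using (hasDerivAt_id t).smul_const w
        exact (HasFDerivAt.comp_hasDerivAt t hd hl).hasDerivWithinAt
  have hsubr : ∀ w ∈ Metric.closedBall (0 : D) r, w ∈ Metric.ball (0 : D) r₀ := fun w hw =>
    Metric.closedBall_subset_ball hrr₀ hw
  -- the projections of the curves are close to the identity
  have happ : ApproximatesLinearOn (fun w => P (φ (q a w x) - u₀)) (ContinuousLinearMap.id ℝ D)
      (Metric.closedBall 0 r) (1 / 2) := by
    intro w₁ hw₁ w₂ hw₂
    have := (convex_closedBall (0 : D) r).norm_image_sub_le_of_norm_hasFDerivWithin_le'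
      (f := fun w => P (φ (q a w x) - u₀)) (f' := fun w => P ∘L Θ (a, w, φ (q a w x)))
      (φ := ContinuousLinearMap.id ℝ D) (C := 1 / 2) (x := w₂) (y := w₁) ?_ ?_ hw₂ hw₁
    · simpa using this
    · intro w hw
      have hd := hder a w x (hNw _ (hsubr w hw)) (hstay w hw).1
      exact (P.hasFDerivAt.comp w (hd.sub_const u₀)).hasFDerivWithinAt
    · intro w hw
      have hk := (key a ha w (hsubr w hw) _ (hstay w hw).2).1
      rw [dist_eq_norm] at hk
      rw [← hP, ← ContinuousLinearMap.comp_sub]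
      calc ‖P ∘L (Θ (a, w, φ (q a w x)) - Θ₀)‖ ≤ ‖P‖ * c :=
            (ContinuousLinearMap.opNorm_comp_le _ _).trans (by gcongr)
        _ ≤ (‖P‖ + 1) * (1 / (2 * (‖P‖ + 1))) := by
            gcongr
            · linarith
            · exact min_le_right _ _
        _ = 1 / 2 := by field_simp
  -- Quantitative surjectivity near the identity: the image of the closed ball of radius `r`
  -- contains the closed ball of radius `(1 - 1 / 2) * r` about the value at `0`.
  let idinv : (ContinuousLinearMap.id ℝ D).NonlinearRightInverse :=
    { toFun := id
      nnnorm := 1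
      bound' := fun y => by simp
      right_inv' := fun y => rfl }
  have hsurj := happ.surjOn_closedBall_of_nonlinearRightInverse idinv hrpos.le Subset.rfl
  have hmem : (0 : D) ∈ Metric.closedBall ((fun w => P (φ (q a w x) - u₀)) 0)
      ((((idinv.nnnorm : NNReal) : ℝ)⁻¹ - ((1 / 2 : NNReal) : ℝ)) * r) := by
    have hid : ((idinv.nnnorm : NNReal) : ℝ) = 1 := rfl
    rw [Metric.mem_closedBall, dist_zero_left, hid]
    simp only [hq0x, hφx]
    have hu' : ‖u - u₀‖ < r / (2 * (‖P‖ + 1)) := by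
      rw [← dist_eq_norm]; exact (Metric.mem_ball.mp hu).trans_le (min_le_right _ _)
    calc ‖P (u - u₀)‖ ≤ ‖P‖ * ‖u - u₀‖ := P.le_opNorm _
      _ ≤ (‖P‖ + 1) * (r / (2 * (‖P‖ + 1))) := by gcongr; linarith
      _ = r / 2 := by field_simp
      _ = _ := by push_cast; ring
  obtain ⟨w, hw, hw0⟩ := hsurj hmem
  exact ⟨w, hNw w (hsubr w hw), (hstay w hw).1, (key a ha w (hsubr w hw) _ (hstay w hw).2).2.2.1,
    hw0⟩

end Chart

/-! ### Linear algebra of a symmetric Fredholm operator of index zero -/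

section LinearAlgebra

variable {E W : Type*} [AddCommGroup E] [Module ℝ E] [AddCommGroup W] [Module ℝ W]
  {J i : E →ₗ[ℝ] W} {b : W →ₗ[ℝ] W →ₗ[ℝ] ℝ}

/-- Let `J` be a Fredholm operator of index zero which is symmetric for an inner product. Then its
kernel is complementary to its range, and the domain has no nonzero orthogonal vectors. -/
theorem isCompl_range_of_symmetric (hi : Function.Injective i)
    (hpos : ∀ v, v ≠ 0 → 0 < b v v) (hJ : ∀ v w, b (J v) (i w) = b (J w) (i v))
    [FiniteDimensional ℝ (LinearMap.ker J)] [FiniteDimensional ℝ (W ⧸ LinearMap.range J)]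
    (hind : Module.finrank ℝ (LinearMap.ker J) = Module.finrank ℝ (W ⧸ LinearMap.range J)) :
    IsCompl (LinearMap.range J) ((LinearMap.ker J).map i) ∧
      ∀ e, (∀ w, b e (i w) = 0) → e = 0 := by
  have hdef : ∀ v, b v v = 0 → v = 0 := fun v hv => by
    by_contra h
    exact (hpos v h).ne' hv
  -- the radical, its image, and the quotient map
  set K : Submodule ℝ E := { carrier := {v | ∀ w, b (J v) (i w) = 0}
                             add_mem' := fun hx hy w => by simp [hx w, hy w]
                             zero_mem' := fun w => by simp
                             smul_mem' := fun c x hx w => by simp [hx w] } with hK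
  have hker : LinearMap.ker J ≤ K := fun v hv w => by simp [LinearMap.mem_ker.mp hv]
  have horth : ∀ κ ∈ K, ∀ v, b (J v) (i κ) = 0 := fun κ hκ v => by rw [hJ]; exact hκ v
  -- If `i κ = J v` with `κ` in the radical, then `b (i κ) (i κ) = b (J v) (i κ) = b (J κ) (i v) =
  -- 0`.
  have hdisj : ∀ κ ∈ K, i κ ∈ LinearMap.range J → κ = 0 := by
    rintro κ hκ ⟨v, hv⟩
    have h := horth κ hκ v
    rw [hv] at h
    exact hi (by rw [hdef _ h, map_zero])
  let qK : K →ₗ[ℝ] W ⧸ LinearMap.range J := (LinearMap.range J).mkQ ∘ₗ i ∘ₗ K.subtype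
  have hqK : Function.Injective qK := by
    rw [← LinearMap.ker_eq_bot, LinearMap.ker_eq_bot']
    rintro ⟨κ, hκ⟩ h
    have : i κ ∈ LinearMap.range J := by simpa [qK] using h
    exact Subtype.ext (hdisj κ hκ this)
  have : FiniteDimensional ℝ K := FiniteDimensional.of_injective qK hqK
  -- The radical contains `ker J` and embeds in the cokernel, which has the same dimension. Index
  -- zero thus forces the radical to be `ker J` and the embedding to be onto.
  have hle : Module.finrank ℝ K ≤ Module.finrank ℝ (LinearMap.ker J) :=
    hind ▸ LinearMap.finrank_le_finrank_of_injective hqK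
  have hKeq : LinearMap.ker J = K := Submodule.eq_of_le_of_finrank_le hker hle
  have hsurj : Function.Surjective qK := by
    rw [← LinearMap.injective_iff_surjective_of_finrank_eq_finrank]
    · exact hqK
    · rw [← hind, hKeq]
  have hsplit : ∀ e : W, ∃ v, ∃ κ ∈ K, e = J v + i κ := by
    intro e
    obtain ⟨⟨κ, hκ⟩, h⟩ := hsurj ((LinearMap.range J).mkQ e)
    have h' : (LinearMap.range J).mkQ (e - i κ) = 0 := by
      rw [map_sub, ← h]; simp [qK]
    obtain ⟨v, hv⟩ := (Submodule.Quotient.mk_eq_zero _).mp h'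
    exact ⟨v, κ, hκ, by rw [hv]; abel⟩
  have hnull : ∀ v, (∀ w, b (J v) (i w) = 0) → J v = 0 := fun v hv => by
    have : v ∈ K := hv
    rw [← hKeq] at this
    exact this
  refine ⟨⟨?_, ?_⟩, ?_⟩
  · rw [Submodule.disjoint_def]
    rintro _ hx ⟨κ, hκ, rfl⟩
    rw [hdisj κ (hker hκ) hx, map_zero]
  · rw [codisjoint_iff, eq_top_iff]
    intro e _
    obtain ⟨v, κ, hκ, rfl⟩ := hsplit e
    exact Submodule.add_mem_sup ⟨v, rfl⟩ ⟨κ, by rw [SetLike.mem_coe, hKeq]; exact hκ, rfl⟩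
  · intro e he
    obtain ⟨v, κ, hκ, rfl⟩ := hsplit e
    have h0 : i κ = 0 := hdef _ (by simpa [horth κ hκ v] using he κ)
    rw [h0, add_zero] at he ⊢
    exact hnull v he

/-- If the range of `J` is complementary to the image of its kernel under the injective map `i`, then
adding to `J` the composition of `i` and a projection onto its kernel makes it bijective. -/
theorem bijective_add_projection (hi : Function.Injective i)
    (hc : IsCompl (LinearMap.range J) ((LinearMap.ker J).map i)) {P : E →ₗ[ℝ] LinearMap.ker J}
    (hP : ∀ κ : LinearMap.ker J, P κ = κ) : Function.Bijective fun v => J v + i (P v) := by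
  refine ⟨(injective_iff_map_eq_zero (J + i ∘ₗ (LinearMap.ker J).subtype ∘ₗ P)).mpr ?_,
    fun η => ?_⟩
  · intro v hv
    have h1 : J v + i (P v) = 0 := hv
    have h2 : i (P v) = 0 := by
      refine Submodule.disjoint_def.mp hc.disjoint _ ⟨-v, ?_⟩ ⟨(P v : E), (P v).2, rfl⟩
      rw [map_neg, neg_eq_of_add_eq_zero_right h1]
    have hvK : J v = 0 := by rwa [h2, add_zero] at h1
    have h3 : (P v : E) = 0 := hi (by rw [h2, map_zero])
    rwa [hP ⟨v, hvK⟩] at h3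
  · obtain ⟨x, y, ⟨v, rfl⟩, ⟨κ, hκ, rfl⟩, rfl⟩ :=
      Submodule.codisjoint_iff_exists_add_eq.mp hc.codisjoint η
    -- Changing `v` by an element of `ker J` leaves `J v` unchanged, so its component under `P` can
    -- be replaced by `κ`.
    have h1 : P (v - (P v : E) + κ) = ⟨κ, hκ⟩ := by
      rw [map_add, map_sub, hP, hP ⟨κ, hκ⟩, sub_self, zero_add]
    refine ⟨v - (P v : E) + κ, ?_⟩
    simp only [h1, map_add, map_sub, LinearMap.mem_ker.mp (P v).2, LinearMap.mem_ker.mp hκ, sub_zero,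
      add_zero]

end LinearAlgebra

/-! ### The implicit function theorem on a slice -/

section Slice

/-- If `u ↦ σ (a₀, u)` has derivative `T` at a zero `u₀`, with `T + ι ∘ P` bijective, and near
`(a₀, u₀)` the values of `σ` in the range of `ι` vanish, then the zeros `u` of `σ (a, ·)` on the
slice `P (u - u₀) = 0` form a graph over `a`. -/
theorem exists_zero_on_slice {A E F D : Type*}
    [NormedAddCommGroup A] [NormedSpace ℝ A] [CompleteSpace A]
    [NormedAddCommGroup E] [NormedSpace ℝ E] [CompleteSpace E]
    [NormedAddCommGroup F] [NormedSpace ℝ F] [CompleteSpace F]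
    [NormedAddCommGroup D] [NormedSpace ℝ D]
    {σ : A × E → F} {σ' : A × E →L[ℝ] F} {a₀ : A} {u₀ : E} (hσ : HasStrictFDerivAt σ σ' (a₀, u₀))
    (h0 : σ (a₀, u₀) = 0) {ι : D →L[ℝ] F} {P : E →L[ℝ] D}
    (hbij : Function.Bijective fun v => σ' (0, v) + ι (P v))
    (hι : ∀ᶠ z in 𝓝 (a₀, u₀), ∀ κ, σ z = ι κ → κ = 0) :
    ∃ ξ : A → E, Filter.Tendsto ξ (𝓝 a₀) (𝓝 u₀) ∧ (∀ᶠ a in 𝓝 a₀, σ (a, ξ a) = 0) ∧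
      ∀ᶠ z in 𝓝 (a₀, u₀), σ z = 0 → P (z.2 - u₀) = 0 → z.2 = ξ z.1 := by
  -- On the slice `M` coincides with `σ`; off it, the extra term supplies the directions missing
  -- from the range of the derivative of `σ`.
  set M : A × E → F := fun z => σ z + ι (P (z.2 - u₀)) with hM
  set M' : A × E →L[ℝ] F := σ' + ι ∘L P ∘L ContinuousLinearMap.snd ℝ A E with hM'
  have hMd : HasStrictFDerivAt M M' (a₀, u₀) := by
    refine hσ.add ?_
    exact (ι ∘L P).hasStrictFDerivAt.comp (a₀, u₀) (hasStrictFDerivAt_snd.sub_const u₀)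
  have hinv : (M' ∘L .inr ℝ A E).IsInvertible := by
    refine ⟨ContinuousLinearEquiv.ofBijective (M' ∘L .inr ℝ A E) ?_ ?_, rfl⟩
    · rw [LinearMap.ker_eq_bot]
      exact hbij.1
    · rw [LinearMap.range_eq_top]
      exact hbij.2
  have hM0 : M (a₀, u₀) = 0 := by simp [hM, h0]
  refine ⟨hMd.implicitFunctionOfProdDomain hinv, hMd.tendsto_implicitFunctionOfProdDomain hinv,
    ?_, ?_⟩
  · have hten : Filter.Tendsto (fun a => (a, hMd.implicitFunctionOfProdDomain hinv a)) (𝓝 a₀)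
        (𝓝 (a₀, u₀)) :=
      Filter.tendsto_id.prodMk_nhds (hMd.tendsto_implicitFunctionOfProdDomain hinv)
    filter_upwards [hMd.eventually_apply_implicitFunctionOfProdDomain hinv, hten.eventually hι]
      with a ha hιa
    rw [hM0] at ha
    -- A zero of `M` has `σ` in the range of `ι`, where `hι` forces it to vanish.
    have h1 : σ (a, hMd.implicitFunctionOfProdDomain hinv a) =
        ι (-P (hMd.implicitFunctionOfProdDomain hinv a - u₀)) := by
      rw [map_neg]
      exact eq_neg_of_add_eq_zero_left ha
    rw [h1, hιa _ h1, map_zero]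
  · filter_upwards [hMd.eventually_apply_eq_iff_implicitFunctionOfProdDomain hinv] with z hz hz0 hzP
    exact (hz.mp (by rw [hM0, hM]; simp only [hz0, hzP, map_zero, add_zero])).symm

/-- A continuous family of functions, homogeneous of degree two on a finite-dimensional space, that
is positive definite at one parameter is positive definite at all nearby parameters. -/
theorem eventually_pos_of_homogeneous {Y D : Type*} [TopologicalSpace Y]
    [NormedAddCommGroup D] [NormedSpace ℝ D] [FiniteDimensional ℝ D]
    {β : Y → D → ℝ} {y₀ : Y} (hcont : ∀ κ, ContinuousAt (fun z : Y × D => β z.1 z.2) (y₀, κ))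
    (hhom : ∀ y (c : ℝ) κ, β y (c • κ) = c ^ 2 * β y κ) (hpos : ∀ κ, κ ≠ 0 → 0 < β y₀ κ) :
    ∀ᶠ y in 𝓝 y₀, ∀ κ, κ ≠ 0 → 0 < β y κ := by
  -- Homogeneity reduces positivity to the unit sphere, whose compactness makes the neighbourhood of
  -- `y₀` uniform.
  have hsphere : ∀ᶠ y in 𝓝 y₀, ∀ κ ∈ Metric.sphere (0 : D) 1, 0 < β y κ := by
    refine (isCompact_sphere (0 : D) 1).eventually_forall_of_forall_eventually fun κ hκ => ?_
    refine (hcont κ).eventually_const_lt (hpos κ ?_)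
    exact Metric.ne_of_mem_sphere hκ one_ne_zero
  filter_upwards [hsphere] with y hy κ hκ
  have hκ' : ‖κ‖ ≠ 0 := norm_ne_zero_iff.mpr hκ
  have := hy (‖κ‖⁻¹ • κ) (by simp [norm_smul, hκ'])
  rw [hhom] at this
  exact (mul_pos_iff_of_pos_left (by positivity)).mp this

end Slice

/-! ### Local families of group elements -/

section Groups

variable {EΛ : Type*} [NormedAddCommGroup EΛ] [NormedSpace ℝ EΛ]
  {Λ : Type*} [TopologicalSpace Λ] [ChartedSpace EΛ Λ]
  {EG : Type*} [NormedAddCommGroup EG] [NormedSpace ℝ EG]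
  {𝒢 : Type*} [TopologicalSpace 𝒢] [ChartedSpace EG 𝒢]

/-- Near the unit over `l₀`, a family `g a w` of elements of the group over the point of coordinate
`a`, smooth in `(a, w)` in a neighbourhood `N` of `(a₀, 0)`, with `g a 0` the unit. -/
structure LocalFamily (B : LieGroupBundle EΛ Λ EG 𝒢) (c : OpenPartialHomeomorph Λ EΛ)
    {D : Type*} [NormedAddCommGroup D] [NormedSpace ℝ D] (N : Set (EΛ × D)) (g : EΛ → D → 𝒢) :
    Prop where
  isOpen : IsOpen N
  mem_target : ∀ z ∈ N, z.1 ∈ c.target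
  proj_eq : ∀ z ∈ N, B.proj (g z.1 z.2) = c.symm z.1
  zero_eq : ∀ a, (a, (0 : D)) ∈ N → g a 0 = B.one (c.symm a)
  contMDiffOn : ContMDiffOn 𝓘(ℝ, EΛ × D) 𝓘(ℝ, EG) ∞ (fun z : EΛ × D => g z.1 z.2) N

/-- Near any unit there is a local family of group elements whose velocities at the unit exhaust
the Lie algebra. -/
theorem LieGroupBundle.exists_localFamily.{u, v₁, v₂, v₃} {EΛ : Type v₁} [NormedAddCommGroup EΛ]
    [NormedSpace ℝ EΛ] {Λ : Type v₂} [TopologicalSpace Λ] [ChartedSpace EΛ Λ]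
    {EG : Type u} [NormedAddCommGroup EG] [NormedSpace ℝ EG]
    {𝒢 : Type v₃} [TopologicalSpace 𝒢] [ChartedSpace EG 𝒢]
    [IsManifold 𝓘(ℝ, EΛ) ∞ Λ] [IsManifold 𝓘(ℝ, EG) ∞ 𝒢] [FiniteDimensional ℝ EG]
    (B : LieGroupBundle EΛ Λ EG 𝒢) (l₀ : Λ) :
    ∃ (D : Type u) (_ : NormedAddCommGroup D) (_ : NormedSpace ℝ D) (_ : FiniteDimensional ℝ D)
      (c : OpenPartialHomeomorph Λ EΛ) (N : Set (EΛ × D)) (g : EΛ → D → 𝒢),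
      l₀ ∈ c.source ∧ c ∈ IsManifold.maximalAtlas 𝓘(ℝ, EΛ) ∞ Λ ∧ (c l₀, (0 : D)) ∈ N ∧
      LocalFamily B c N g ∧
      ∀ v ∈ B.lieAlg l₀, ∃ (w : D) (L : D →L[ℝ] EG),
        HasMFDerivAt 𝓘(ℝ, D) 𝓘(ℝ, EG) (g (c l₀)) 0 L ∧ L w = v := by
  obtain ⟨D, _, _, hsub⟩ := B.isSubmersion_proj
  have h := hsub (B.one l₀)
  set d := h.domChart with hd
  set c := h.codChart with hc
  set e := h.equiv with he
  have hd0 : B.one l₀ ∈ d.source := h.mem_domChart_source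
  have hc0 : l₀ ∈ c.source := by
    have := h.mem_codChart_source
    rwa [B.proj_one] at this
  have hdA : d ∈ IsManifold.maximalAtlas 𝓘(ℝ, EG) ∞ 𝒢 := h.domChart_mem_maximalAtlas
  have hcA : c ∈ IsManifold.maximalAtlas 𝓘(ℝ, EΛ) ∞ Λ := h.codChart_mem_maximalAtlas
  have hsrc : ∀ p ∈ d.source, B.proj p ∈ c.source := h.source_subset_preimage_source
  have hwr : ∀ y ∈ d.target, c (B.proj (d.symm y)) = (e y).1 := fun y hy => by
    have hy' : y ∈ (h.domChart.extend 𝓘(ℝ, EG)).target := by simpa using! hy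
    have := h.writtenInCharts hy'
    simpa using this
  have hwr' : ∀ p ∈ d.source, (e (d p)).1 = c (B.proj p) := fun p hp => by
    rw [← hwr _ (d.map_source hp), d.left_inv hp]
  have hfin : FiniteDimensional ℝ D := by
    have : FiniteDimensional ℝ (EΛ × D) := LinearEquiv.finiteDimensional e.toLinearEquiv
    exact FiniteDimensional.of_injective (LinearMap.inr ℝ EΛ D) LinearMap.inr_injective
  -- In the submersion charts the unit section is the graph of `s`. Translating the vertical
  -- coordinate by `s` places the units at `w = 0`.
  set s : EΛ → D := fun a => (e (d (B.one (c.symm a)))).2 with hs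
  set j : EΛ × D → EG := fun z => e.symm (z.1, s z.1 + z.2) with hj
  set N₁ : Set EΛ := c.target ∩ c.symm ⁻¹' (B.one ⁻¹' d.source) with hN₁
  have hN₁o : IsOpen N₁ :=
    c.symm.isOpen_inter_preimage (d.open_source.preimage B.contMDiff_one.continuous)
  have hsm : ContMDiffOn 𝓘(ℝ, EΛ) 𝓘(ℝ, D) ∞ s N₁ := by
    have h1 : ContMDiffOn 𝓘(ℝ, EΛ) 𝓘(ℝ, EG) ∞ (fun a => d (B.one (c.symm a))) N₁ :=
      (contMDiffOn_of_mem_maximalAtlas hdA).comp (B.contMDiff_one.comp_contMDiffOn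
        ((contMDiffOn_symm_of_mem_maximalAtlas hcA).mono inter_subset_left)) fun a ha => ha.2
    exact (ContinuousLinearMap.snd ℝ EΛ D ∘L
      (e : EG →L[ℝ] EΛ × D)).contDiff.contMDiff.comp_contMDiffOn h1
  have hjm : ContMDiffOn 𝓘(ℝ, EΛ × D) 𝓘(ℝ, EG) ∞ j (N₁ ×ˢ univ) := by
    rw [contMDiffOn_iff_contDiffOn] at hsm ⊢
    refine e.symm.contDiff.comp_contDiffOn 
      (contDiffOn_fst.prodMk (ContDiffOn.add ?_ contDiffOn_snd))
    exact hsm.comp contDiffOn_fst fun z hz => hz.1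
  set N : Set (EΛ × D) := (N₁ ×ˢ univ) ∩ j ⁻¹' d.target with hN
  have hNo : IsOpen N :=
    hjm.continuousOn.isOpen_inter_preimage (hN₁o.prod isOpen_univ) d.open_target
  have hj0 : ∀ a ∈ N₁, j (a, 0) = d (B.one (c.symm a)) := by
    intro a ha
    have h1 := hwr' _ ha.2
    rw [B.proj_one, c.right_inv ha.1] at h1
    simp only [hj, hs, add_zero]
    rw [e.symm_apply_eq]
    exact Prod.ext h1.symm rfl
  have ha0 : c l₀ ∈ N₁ := ⟨c.map_source hc0, by
    rw [mem_preimage, mem_preimage, c.left_inv hc0]; exact hd0⟩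
  have h00 : (c l₀, (0 : D)) ∈ N := ⟨⟨ha0, mem_univ _⟩, by
    rw [mem_preimage, hj0 _ ha0]; exact d.map_source ha0.2⟩
  refine ⟨D, _, _, hfin, c, N, fun a w => d.symm (j (a, w)), hc0, hcA, h00, ?_, ?_⟩
  · refine ⟨hNo, fun z hz => hz.1.1.1, fun z hz => ?_, fun a ha => ?_, ?_⟩
    · have h1 := hwr _ hz.2
      have h2 : (e (j z)).1 = z.1 := by simp [hj]
      rw [h2] at h1
      have h3 := c.left_inv (hsrc _ (d.map_target hz.2))
      rw [h1] at h3
      exact h3.symm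
    · rw [hj0 a ha.1.1, d.left_inv ha.1.1.2]
    · exact (contMDiffOn_symm_of_mem_maximalAtlas hdA).comp (hjm.mono inter_subset_left)
        fun z hz => hz.2
  · intro v hv
    have hdd : MDifferentiableAt 𝓘(ℝ, EG) 𝓘(ℝ, EG) d (B.one l₀) :=
      (contMDiffAt_of_mem_maximalAtlas hdA hd0).mdifferentiableAt (by simp)
    have hds : MDifferentiableAt 𝓘(ℝ, EG) 𝓘(ℝ, EG) d.symm (d (B.one l₀)) :=
      (contMDiffAt_symm_of_mem_maximalAtlas hdA (d.map_source hd0)).mdifferentiableAt (by simp)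
    have hcd : MDifferentiableAt 𝓘(ℝ, EΛ) 𝓘(ℝ, EΛ) c (B.proj (B.one l₀)) :=
      (contMDiffAt_of_mem_maximalAtlas hcA (hsrc _ hd0)).mdifferentiableAt (by simp)
    have hpd : MDifferentiableAt 𝓘(ℝ, EG) 𝓘(ℝ, EΛ) B.proj (B.one l₀) :=
      h.contMDiffAt.mdifferentiableAt (by simp)
    set dv : EG := mfderiv 𝓘(ℝ, EG) 𝓘(ℝ, EG) d (B.one l₀) v with hdv
    -- the vertical vector `v` is vertical in the charts
    have hfst : (e dv).1 = 0 := by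
      have h1 : HasMFDerivAt 𝓘(ℝ, EG) 𝓘(ℝ, EΛ) (fun p => (e (d p)).1) (B.one l₀)
          ((ContinuousLinearMap.fst ℝ EΛ D ∘L (e : EG →L[ℝ] EΛ × D)) ∘L
            (mfderiv 𝓘(ℝ, EG) 𝓘(ℝ, EG) d (B.one l₀) : EG →L[ℝ] EG)) :=
        HasMFDerivAt.comp (g := fun y : EG => (e y).1) (I' := 𝓘(ℝ, EG)) (B.one l₀)
          (ContinuousLinearMap.hasMFDerivAt
          (ContinuousLinearMap.fst ℝ EΛ D ∘L (e : EG →L[ℝ] EΛ × D))) hdd.hasMFDerivAt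
      have h2 := HasMFDerivAt.comp (B.one l₀) hcd.hasMFDerivAt hpd.hasMFDerivAt
      have h3 : (fun p => (e (d p)).1) =ᶠ[𝓝 (B.one l₀)] (c ∘ B.proj) :=
        Filter.eventually_of_mem (d.open_source.mem_nhds hd0) hwr'
      have h4 := hasMFDerivAt_unique h1 (h2.congr_of_eventuallyEq h3)
      have h5 := congrArg (fun T : EG →L[ℝ] EΛ => T v) h4
      refine h5.trans ?_
      have h6 : mfderiv 𝓘(ℝ, EG) 𝓘(ℝ, EΛ) B.proj (B.one l₀) v = 0 := hv
      change mfderiv 𝓘(ℝ, EΛ) 𝓘(ℝ, EΛ) c (B.proj (B.one l₀))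
        (mfderiv 𝓘(ℝ, EG) 𝓘(ℝ, EΛ) B.proj (B.one l₀) v) = 0
      rw [h6, map_zero]
    have hj00 : j (c l₀, 0) = d (B.one l₀) := by rw [hj0 _ ha0, c.left_inv hc0]
    refine ⟨(e dv).2, (mfderiv 𝓘(ℝ, EG) 𝓘(ℝ, EG) d.symm (d (B.one l₀)) : EG →L[ℝ] EG) ∘L
      (e.symm : EΛ × D →L[ℝ] EG) ∘L ContinuousLinearMap.inr ℝ EΛ D, ?_, ?_⟩
    · have h1 : HasMFDerivAt 𝓘(ℝ, D) 𝓘(ℝ, EG) (fun w => j (c l₀, w)) 0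
          ((e.symm : EΛ × D →L[ℝ] EG) ∘L ContinuousLinearMap.inr ℝ EΛ D) := by
        rw [hasMFDerivAt_iff_hasFDerivAt]
        have h2 : HasFDerivAt (fun w : D => (c l₀, s (c l₀) + w))
            (ContinuousLinearMap.inr ℝ EΛ D) 0 :=
          (hasFDerivAt_const (c l₀) (0 : D)).prodMk ((hasFDerivAt_id (0 : D)).const_add (s (c l₀)))
        exact e.symm.hasFDerivAt.comp (0 : D) h2
      have h2 := hds.hasMFDerivAt
      rw [← hj00] at h2
      have h3 := HasMFDerivAt.comp (0 : D) h2 h1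
      rw [hj00] at h3
      exact h3
    · have h1 : e.symm (0, (e dv).2) = dv := by
        rw [e.symm_apply_eq]; exact Prod.ext hfst.symm rfl
      have h2 := HasMFDerivAt.comp (B.one l₀) hds.hasMFDerivAt hdd.hasMFDerivAt
      have h3 : (id : 𝒢 → 𝒢) =ᶠ[𝓝 (B.one l₀)] (d.symm ∘ d) :=
        Filter.eventually_of_mem (d.open_source.mem_nhds hd0) fun p hp => (d.left_inv hp).symm
      have h4 := hasMFDerivAt_unique (hasMFDerivAt_id (B.one l₀)) (h2.congr_of_eventuallyEq h3)
      have h5 := congrArg (fun T : EG →L[ℝ] EG => T v) h4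
      change mfderiv 𝓘(ℝ, EG) 𝓘(ℝ, EG) d.symm (d (B.one l₀)) (e.symm (0, (e dv).2)) = v
      rw [h1]
      exact h5.symm

end Groups

/-! ### Velocities of local families along orbits -/

section Velocity

variable {EΛ : Type*} [NormedAddCommGroup EΛ] [NormedSpace ℝ EΛ]
  {Λ : Type*} [TopologicalSpace Λ] [ChartedSpace EΛ Λ]
  {EG : Type*} [NormedAddCommGroup EG] [NormedSpace ℝ EG]
  {𝒢 : Type*} [TopologicalSpace 𝒢] [ChartedSpace EG 𝒢]
  {B : LieGroupBundle EΛ Λ EG 𝒢}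
  {D : Type*} [NormedAddCommGroup D] [NormedSpace ℝ D]
  {c : OpenPartialHomeomorph Λ EΛ} {N : Set (EΛ × D)} {g : EΛ → D → 𝒢}

/-- Linear reparametrization of a local family. -/
theorem LocalFamily.comp_clm (h : LocalFamily B c N g) {K : Type*} [NormedAddCommGroup K]
    [NormedSpace ℝ K] (L : K →L[ℝ] D) :
    LocalFamily B c ((fun z : EΛ × K => (z.1, L z.2)) ⁻¹' N) (fun a κ => g a (L κ)) where
  isOpen := h.isOpen.preimage (by fun_prop)
  mem_target z hz := h.mem_target _ hz
  proj_eq z hz := h.proj_eq _ hz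
  zero_eq a ha := by
    rw [mem_preimage, map_zero] at ha
    rw [map_zero]
    exact h.zero_eq a ha
  contMDiffOn := by
    refine h.contMDiffOn.comp (t := N) (f := fun z : EΛ × K => (z.1, L z.2)) ?_ fun z hz => hz
    refine ContDiff.contMDiff ?_ |>.contMDiffOn
    exact contDiff_fst.prodMk (L.contDiff.comp contDiff_snd)

/-- The domain of the family of quotients `g a w' * (g a w)⁻¹`. -/
def quotDomain (N : Set (EΛ × D)) : Set (EΛ × D × D) :=
  {z | (z.1, z.2.1) ∈ N ∧ (z.1, z.2.2) ∈ N}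

/-- The family of quotients `g a w' * (g a w)⁻¹`. -/
def LieGroupBundle.quotFamily (B : LieGroupBundle EΛ Λ EG 𝒢) (g : EΛ → D → 𝒢)
    (z : EΛ × D × D) : 𝒢 :=
  B.mul (g z.1 z.2.1) (B.inv (g z.1 z.2.2))

namespace LocalFamily

theorem isOpen_quotDomain (h : LocalFamily B c N g) : IsOpen (quotDomain N) :=
  (h.isOpen.preimage (by fun_prop : Continuous fun z : EΛ × D × D => (z.1, z.2.1))).inter
    (h.isOpen.preimage (by fun_prop : Continuous fun z : EΛ × D × D => (z.1, z.2.2)))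

theorem proj_quotFamily (h : LocalFamily B c N g) {z : EΛ × D × D} (hz : z ∈ quotDomain N) :
    B.proj (B.quotFamily g z) = c.symm z.1 := by
  rw [LieGroupBundle.quotFamily, B.proj_mul, h.proj_eq _ hz.1]
  rw [B.proj_inv, h.proj_eq _ hz.1, h.proj_eq _ hz.2]

theorem quotFamily_self (h : LocalFamily B c N g) {a : EΛ} {w : D} (hz : (a, w) ∈ N) :
    B.quotFamily g (a, w, w) = B.one (c.symm a) := by
  rw [LieGroupBundle.quotFamily, B.mul_inv, h.proj_eq _ hz]

theorem eventually_mem (h : LocalFamily B c N g) {a : EΛ} {w : D} (hz : (a, w) ∈ N) :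
    ∀ᶠ w' in 𝓝 w, (a, w') ∈ N :=
  (by fun_prop : ContinuousAt (fun w' : D => (a, w')) w) (h.isOpen.mem_nhds hz)

/-- Orbit maps are only known to be differentiable at the unit. Factoring out `g a w` turns the
curve near parameter `w` into one that starts at the unit and acts on the point already reached. -/
theorem act_eq_act_quotFamily (h : LocalFamily B c N g) {a : EΛ} {w w' : D} (hz : (a, w) ∈ N)
    (hz' : (a, w') ∈ N) {E : Type*} [NormedAddCommGroup E] [NormedSpace ℝ E]
    {X : Type*} [TopologicalSpace X] [ChartedSpace E X] (A : Action B E X) (x : X) :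
    A.act (g a w') x = A.act (B.quotFamily g (a, w', w)) (A.act (g a w) x) := by
  have h1 : B.proj (g a w') = c.symm a := h.proj_eq _ hz'
  have h2 : B.proj (g a w) = c.symm a := h.proj_eq _ hz
  rw [LieGroupBundle.quotFamily, ← A.mul_act, B.mul_assoc, B.inv_mul, h2, ← h1, B.mul_one]
  · rw [B.proj_inv, h1, h2]
  · rw [B.proj_inv]
  · rw [B.proj_mul, h1, h2]
    rw [B.proj_inv, h1, h2]

theorem eventually_proj_quotFamily (h : LocalFamily B c N g) {a : EΛ} {w : D} (hz : (a, w) ∈ N) :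
    ∀ᶠ w' in 𝓝 w, B.proj (B.quotFamily g (a, w', w)) = c.symm a := by
  filter_upwards [h.eventually_mem hz] with w' hw'
  exact h.proj_quotFamily (z := (a, w', w)) ⟨hw', hz⟩

theorem contMDiffOn_quotFamily [IsManifold 𝓘(ℝ, EG) ∞ 𝒢] (h : LocalFamily B c N g) :
    ContMDiffOn 𝓘(ℝ, EΛ × D × D) 𝓘(ℝ, EG) ∞ (B.quotFamily g) (quotDomain N) := by
  have h1 : ContMDiffOn 𝓘(ℝ, EΛ × D × D) 𝓘(ℝ, EG) ∞ (fun z : EΛ × D × D => g z.1 z.2.1)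
      (quotDomain N) :=
    h.contMDiffOn.comp (f := fun z : EΛ × D × D => (z.1, z.2.1))
      (ContDiff.contMDiff (by fun_prop)).contMDiffOn fun z hz => hz.1
  have h2 : ContMDiffOn 𝓘(ℝ, EΛ × D × D) 𝓘(ℝ, EG) ∞ (fun z : EΛ × D × D => g z.1 z.2.2)
      (quotDomain N) :=
    h.contMDiffOn.comp (f := fun z : EΛ × D × D => (z.1, z.2.2))
      (ContDiff.contMDiff (by fun_prop)).contMDiffOn fun z hz => hz.2
  refine B.contMDiffOn_mul.comp (h1.prodMk (B.contMDiff_inv.comp_contMDiffOn h2)) fun z hz => ?_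
  change B.proj (g z.1 z.2.1) = B.proj (B.inv (g z.1 z.2.2))
  rw [B.proj_inv, h.proj_eq _ hz.1, h.proj_eq _ hz.2]

end LocalFamily

/-- The derivative at `w' = w` of the quotients `g a w' * (g a w)⁻¹`. -/
noncomputable def LieGroupBundle.velocity (B : LieGroupBundle EΛ Λ EG 𝒢) (N : Set (EΛ × D))
    (g : EΛ → D → 𝒢) (a : EΛ) (w : D) : D →L[ℝ] EG :=
  (mfderivWithin 𝓘(ℝ, EΛ × D × D) 𝓘(ℝ, EG) (B.quotFamily g) (quotDomain N) (a, w, w) :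
    EΛ × D × D →L[ℝ] EG) ∘L ContinuousLinearMap.inr ℝ EΛ (D × D) ∘L ContinuousLinearMap.inl ℝ D D

namespace LocalFamily

variable [IsManifold 𝓘(ℝ, EG) ∞ 𝒢]

theorem hasMFDerivAt_quotFamily (h : LocalFamily B c N g) {a : EΛ} {w : D} (hz : (a, w) ∈ N) :
    HasMFDerivAt 𝓘(ℝ, D) 𝓘(ℝ, EG) (fun w' => B.quotFamily g (a, w', w)) w
      (B.velocity N g a w : D →L[ℝ] EG) := by
  have hO : quotDomain N ∈ 𝓝 (a, w, w) := h.isOpen_quotDomain.mem_nhds ⟨hz, hz⟩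
  have h1 : HasMFDerivAt 𝓘(ℝ, EΛ × D × D) 𝓘(ℝ, EG) (B.quotFamily g) (a, w, w) _ :=
    ((h.contMDiffOn_quotFamily.mdifferentiableOn (by simp)) (a, w, w)
      ⟨hz, hz⟩).hasMFDerivWithinAt.hasMFDerivAt hO
  have h2 : HasFDerivAt (fun w' : D => (a, w', w))
      (ContinuousLinearMap.inr ℝ EΛ (D × D) ∘L ContinuousLinearMap.inl ℝ D D) w := by
    refine ((hasFDerivAt_const a w).prodMk
      ((hasFDerivAt_id w).prodMk (hasFDerivAt_const w w))).congr_fderiv ?_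
    ext <;> simp
  exact HasMFDerivAt.comp (g := B.quotFamily g) w h1 (hasMFDerivAt_iff_hasFDerivAt.mpr h2)

/-- The velocities of a local family as elements of the bundle of Lie algebras. -/
theorem velocity_mem_lieBundle (h : LocalFamily B c N g)
    {a : EΛ} {w : D} (hz : (a, w) ∈ N) (κ : D) :
    (⟨B.quotFamily g (a, w, w), B.velocity N g a w κ⟩ : TangentBundle 𝓘(ℝ, EG) 𝒢)
      ∈ B.lieBundle := by
  refine ⟨?_, ?_⟩
  · change B.quotFamily g (a, w, w) = B.one (B.proj (B.quotFamily g (a, w, w)))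
    rw [h.proj_quotFamily ⟨hz, hz⟩, h.quotFamily_self hz]
  · change mfderiv 𝓘(ℝ, EG) 𝓘(ℝ, EΛ) B.proj (B.quotFamily g (a, w, w))
      (B.velocity N g a w κ) = 0
    have hpd : MDifferentiableAt 𝓘(ℝ, EG) 𝓘(ℝ, EΛ) B.proj (B.quotFamily g (a, w, w)) := by
      obtain ⟨_, _, _, hs⟩ := B.isSubmersion_proj
      exact (hs _).contMDiffAt.mdifferentiableAt (by simp)
    have h1 := HasMFDerivAt.comp w hpd.hasMFDerivAt (h.hasMFDerivAt_quotFamily hz)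
    have h2 : HasMFDerivAt 𝓘(ℝ, D) 𝓘(ℝ, EΛ)
        (B.proj ∘ fun w' => B.quotFamily g (a, w', w)) w (0 : D →L[ℝ] EΛ) := by
      refine (hasMFDerivAt_const (c.symm a) w).congr_of_eventuallyEq ?_
      have : ∀ᶠ w' in 𝓝 w, (a, w') ∈ N :=
        (by fun_prop : ContinuousAt (fun w' : D => (a, w')) w) (h.isOpen.mem_nhds hz)
      filter_upwards [this] with w' hw'
      exact h.proj_quotFamily (z := (a, w', w)) ⟨hw', hz⟩
    exact congrArg (fun T : D →L[ℝ] EΛ => T κ) (hasMFDerivAt_unique h1 h2)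

/-- The velocity is the tangent map of the smooth quotient family applied to the vector `(0, κ, 0)`
at the diagonal point `(a, w, w)`, which varies continuously. -/
theorem continuousOn_velocity (h : LocalFamily B c N g) (κ : D) :
    ContinuousOn (fun z : EΛ × D => (⟨B.quotFamily g (z.1, z.2, z.2), B.velocity N g z.1 z.2 κ⟩ :
      TangentBundle 𝓘(ℝ, EG) 𝒢)) N := by
  have h1 := h.contMDiffOn_quotFamily.continuousOn_tangentMapWithin (by simp)
    h.isOpen_quotDomain.uniqueMDiffOn
  have h2 : Continuous fun z : EΛ × D =>
      (⟨(z.1, z.2, z.2), (0, κ, 0)⟩ : TangentBundle 𝓘(ℝ, EΛ × D × D) (EΛ × D × D)) := by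
    have h3 : Continuous fun z : EΛ × D =>
        (((z.1, z.2, z.2), (0, κ, 0)) : ModelProd (EΛ × D × D) (EΛ × D × D)) :=
      (by fun_prop : Continuous fun z : EΛ × D =>
        (((z.1, z.2, z.2), (0, κ, 0)) : (EΛ × D × D) × (EΛ × D × D)))
    exact (tangentBundleModelSpaceHomeomorph 𝓘(ℝ, EΛ × D × D)).symm.continuous.comp h3
  exact h1.comp h2.continuousOn fun z hz => ⟨hz, hz⟩

end LocalFamily

variable {E : Type*} [NormedAddCommGroup E] [NormedSpace ℝ E]
  {X : Type*} [TopologicalSpace X] [ChartedSpace E X]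
  [IsManifold 𝓘(ℝ, EG) ∞ 𝒢] [IsManifold 𝓘(ℝ, E) ∞ X]

/-- Chain rule for the orbit map along a curve in the group through its unit. -/
theorem Action.IsRegular.hasMFDerivAt_act {A : Action B E X} (hA : A.IsRegular) {l : Λ} {y : X}
    {γ : D → 𝒢} {w : D} {L : D →L[ℝ] EG} (hγ : HasMFDerivAt 𝓘(ℝ, D) 𝓘(ℝ, EG) γ w L)
    (hw : γ w = B.one l) (hl : ∀ᶠ w' in 𝓝 w, B.proj (γ w') = l) :
    HasMFDerivAt 𝓘(ℝ, D) 𝓘(ℝ, E) (fun w' => A.act (γ w') y) w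
      ((A.orbitDeriv l y : EG →L[ℝ] E) ∘L L) := by
  have h1 : ∀ p, p = B.one l → HasMFDerivWithinAt 𝓘(ℝ, EG) 𝓘(ℝ, E) (fun g => A.act g y)
      (B.fiber l) p (A.orbitDeriv l y : EG →L[ℝ] E) := by
    rintro p rfl
    exact (hA.mdifferentiable l y).hasMFDerivWithinAt
  have h2 : HasMFDerivWithinAt 𝓘(ℝ, D) 𝓘(ℝ, E) (fun w' => A.act (γ w') y)
      {w' | B.proj (γ w') = l} w ((A.orbitDeriv l y : EG →L[ℝ] E) ∘L L) :=
    HasMFDerivWithinAt.comp (g := fun g => A.act g y) w (h1 _ hw) hγ.hasMFDerivWithinAt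
      fun w' hw' => hw'
  exact h2.hasMFDerivAt hl

/-- The velocity, in the chart at `x₀`, of the curves `w ↦ g a w · x` when they pass through the
point of coordinate `u`. -/
noncomputable def Action.chartVelocity (A : Action B E X) (c : OpenPartialHomeomorph Λ EΛ)
    (N : Set (EΛ × D)) (g : EΛ → D → 𝒢) (x₀ : X) (z : EΛ × D × E) : D →L[ℝ] E :=
  (mfderiv 𝓘(ℝ, E) 𝓘(ℝ, E) (extChartAt 𝓘(ℝ, E) x₀) ((chartAt E x₀).symm z.2.2) : E →L[ℝ] E) ∘L
    (A.orbitDeriv (c.symm z.1) ((chartAt E x₀).symm z.2.2) : EG →L[ℝ] E) ∘L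
    B.velocity N g z.1 z.2.1

/-- Chain rule for the orbit map followed by a chart. -/
theorem Action.IsRegular.hasFDerivAt_chart_act {A : Action B E X} (hA : A.IsRegular) {l : Λ}
    {x₀ y : X} {γ : D → 𝒢} {w : D} {L : D →L[ℝ] EG}
    (hγ : HasMFDerivAt 𝓘(ℝ, D) 𝓘(ℝ, EG) γ w L)
    (hw : γ w = B.one l) (hl : ∀ᶠ w' in 𝓝 w, B.proj (γ w') = l) (hy : y ∈ (chartAt E x₀).source) :
    HasFDerivAt (fun w' => chartAt E x₀ (A.act (γ w') y))
      ((mfderiv 𝓘(ℝ, E) 𝓘(ℝ, E) (extChartAt 𝓘(ℝ, E) x₀) y : E →L[ℝ] E) ∘L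
        (A.orbitDeriv l y : EG →L[ℝ] E) ∘L L) w := by
  have h1 : ∀ p, p = y → HasMFDerivAt 𝓘(ℝ, E) 𝓘(ℝ, E) (extChartAt 𝓘(ℝ, E) x₀) p
      (mfderiv 𝓘(ℝ, E) 𝓘(ℝ, E) (extChartAt 𝓘(ℝ, E) x₀) y : E →L[ℝ] E) := by
    rintro p rfl
    exact (mdifferentiableAt_extChartAt hy).hasMFDerivAt
  have h2 := HasMFDerivAt.comp w (h1 (A.act (γ w) y) (by rw [hw, A.one_act]))
    (hA.hasMFDerivAt_act hγ hw hl)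
  rw [hasMFDerivAt_iff_hasFDerivAt] at h2
  exact h2

namespace LocalFamily

variable {A : Action B E X}

theorem continuousAt_act (h : LocalFamily B c N g) (hA : A.IsRegular) {a : EΛ} {w : D}
    (hz : (a, w) ∈ N) (x : X) : ContinuousAt (fun w' => A.act (g a w') x) w := by
  have h1 := (hA.hasMFDerivAt_act (y := A.act (g a w) x) (h.hasMFDerivAt_quotFamily hz)
    (h.quotFamily_self hz) (h.eventually_proj_quotFamily hz)).continuousAt
  refine h1.congr ?_
  filter_upwards [h.eventually_mem hz] with w' hw'
  exact (h.act_eq_act_quotFamily hz hw' A x).symm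

/-- The derivative involves `x` only through the point reached. This allows bounds on it that are
uniform in the starting point. -/
theorem hasFDerivAt_act (h : LocalFamily B c N g) (hA : A.IsRegular) {x₀ : X} {a : EΛ} {w : D}
    (hz : (a, w) ∈ N) {x : X} (hx : A.act (g a w) x ∈ (chartAt E x₀).source) :
    HasFDerivAt (fun w' => chartAt E x₀ (A.act (g a w') x))
      (A.chartVelocity c N g x₀ (a, w, chartAt E x₀ (A.act (g a w) x))) w := by
  have h1 := hA.hasFDerivAt_chart_act (h.hasMFDerivAt_quotFamily hz)
    (h.quotFamily_self hz) (h.eventually_proj_quotFamily hz) hx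
  have h2 : (chartAt E x₀).symm (chartAt E x₀ (A.act (g a w) x)) = A.act (g a w) x :=
    (chartAt E x₀).left_inv hx
  have h3 : ∀ y, y = A.act (g a w) x → HasFDerivAt (fun w' => chartAt E x₀ (A.act (g a w') x))
      ((mfderiv 𝓘(ℝ, E) 𝓘(ℝ, E) (extChartAt 𝓘(ℝ, E) x₀) y : E →L[ℝ] E) ∘L
        (A.orbitDeriv (c.symm a) y : EG →L[ℝ] E) ∘L B.velocity N g a w) w := by
    rintro y rfl
    refine h1.congr_of_eventuallyEq ?_
    filter_upwards [h.eventually_mem hz] with w' hw'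
    exact congrArg _ (h.act_eq_act_quotFamily hz hw' A x)
  exact h3 _ h2

/-- Regularity gives continuity of the image of each single vector `κ`; finite dimension of `D`
upgrades this to continuity in operator norm. -/
theorem continuousAt_chartVelocity [FiniteDimensional ℝ D]
    (h : LocalFamily B c N g) (hA : A.IsRegular)
    {x₀ : X} {a : EΛ} {w : D} (hz : (a, w) ∈ N) {u : E} (hu : u ∈ (chartAt E x₀).target) :
    ContinuousAt (A.chartVelocity c N g x₀) (a, w, u) := by
  rw [continuousAt_clm_apply]
  intro κ
  set S : Set (EΛ × D × E) := {z | (z.1, z.2.1) ∈ N ∧ z.2.2 ∈ (chartAt E x₀).target} with hS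
  have hSo : IsOpen S :=
    (h.isOpen.preimage (by fun_prop : Continuous fun z : EΛ × D × E => (z.1, z.2.1))).inter
      ((chartAt E x₀).open_target.preimage (by fun_prop : Continuous fun z : EΛ × D × E => z.2.2))
  suffices ContinuousOn (fun z => A.chartVelocity c N g x₀ z κ) S from
    this.continuousAt (hSo.mem_nhds ⟨hz, hu⟩)
  have h1 : ContinuousOn (fun z : EΛ × D × E =>
      (⟨B.quotFamily g (z.1, z.2.1, z.2.1), B.velocity N g z.1 z.2.1 κ⟩ :
        TangentBundle 𝓘(ℝ, EG) 𝒢)) S :=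
    (h.continuousOn_velocity κ).comp (f := fun z : EΛ × D × E => (z.1, z.2.1)) (by fun_prop)
      fun z hz => hz.1
  have h2 : ContinuousOn (fun z : EΛ × D × E => (chartAt E x₀).symm z.2.2) S :=
    (chartAt E x₀).continuousOn_symm.comp (by fun_prop) fun z hz => hz.2
  have h3 : Continuous fun z : S =>
      ((⟨⟨B.quotFamily g (z.1.1, z.1.2.1, z.1.2.1), B.velocity N g z.1.1 z.1.2.1 κ⟩,
        h.velocity_mem_lieBundle z.2.1 κ⟩, (chartAt E x₀).symm z.1.2.2) : B.lieBundle × X) :=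
    (Continuous.subtype_mk (continuousOn_iff_continuous_domRestrict.mp h1) _).prodMk
      (continuousOn_iff_continuous_domRestrict.mp h2)
  have h4 := hA.continuous_deriv.comp h3
  have h5 : ContinuousOn (trivializationAt E (TangentSpace 𝓘(ℝ, E) : X → Type _) x₀)
      (trivializationAt E (TangentSpace 𝓘(ℝ, E) : X → Type _) x₀).source :=
    (trivializationAt E (TangentSpace 𝓘(ℝ, E) : X → Type _) x₀).continuousOn
  rw [continuousOn_iff_continuous_domRestrict]
  have hbase : ∀ z : S, (chartAt E x₀).symm z.1.2.2 ∈ (chartAt E x₀).source := fun z =>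
    (chartAt E x₀).map_target z.2.2
  have h6 := continuous_snd.comp (h5.comp_continuous h4 fun z => by
    rw [TangentBundle.trivializationAt_source]
    exact hbase z)
  refine h6.congr fun z => ?_
  have hmem : (chartAt E x₀).symm z.1.2.2 ∈
      (trivializationAt E (TangentSpace 𝓘(ℝ, E) : X → Type _) x₀).baseSet := hbase z
  have h7 := TangentBundle.continuousLinearMapAt_trivializationAt (I := 𝓘(ℝ, E)) (hbase z)
  have h8 : B.proj (B.quotFamily g (z.1.1, z.1.2.1, z.1.2.1)) = c.symm z.1.1 :=
    h.proj_quotFamily (z := (z.1.1, z.1.2.1, z.1.2.1)) ⟨z.2.1, z.2.1⟩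
  rw [domRestrict_apply]
  unfold Action.chartVelocity
  rw [← h7, ← h8]
  exact congrFun (Trivialization.coe_linearMapAt_of_mem _ hmem).symm _

/-- The velocity at the base point, through the velocity of the family itself. -/
theorem chartVelocity_base (h : LocalFamily B c N g) (hA : A.IsRegular) {x₀ : X} {l₀ : Λ}
    (hl₀ : l₀ ∈ c.source) (hz : (c l₀, (0 : D)) ∈ N) {L : D →L[ℝ] EG}
    (hL : HasMFDerivAt 𝓘(ℝ, D) 𝓘(ℝ, EG) (g (c l₀)) 0 L) :
    A.chartVelocity c N g x₀ (c l₀, 0, chartAt E x₀ x₀) =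
      (A.orbitDeriv l₀ x₀ : EG →L[ℝ] E) ∘L L := by
  have h0 : g (c l₀) 0 = B.one l₀ := by rw [h.zero_eq _ hz, c.left_inv hl₀]
  have hact : A.act (g (c l₀) 0) x₀ = x₀ := by rw [h0, A.one_act]
  have h1 := h.hasFDerivAt_act (A := A) (x₀ := x₀) (x := x₀) hA hz
    (by rw [hact]; exact mem_chart_source E x₀)
  rw [hact] at h1
  -- At `w = 0` the family itself passes through the unit, so the same derivative is computed
  -- without quotients; uniqueness of derivatives identifies the two.
  have h2 := hA.hasFDerivAt_chart_act (x₀ := x₀) hL h0 (by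
    filter_upwards [h.eventually_mem hz] with w' hw'
    have := h.proj_eq _ hw'
    rwa [c.left_inv hl₀] at this) (mem_chart_source E x₀)
  rw [h1.unique h2, mfderiv_extChartAt_self]
  rfl

end LocalFamily

end Velocity

/-! ### The auxiliary structure in coordinates -/

/-- At a zero `u₀` of `s`, the derivative of `u ↦ b u (s u)` only involves the derivative of `s`,
even if `b` is merely continuous. -/
theorem hasDerivAt_pairing_of_zero {E F : Type*} [NormedAddCommGroup E] [NormedSpace ℝ E]
    [NormedAddCommGroup F] [NormedSpace ℝ F] {b : E → F → ℝ} {s : E → F} {s' : E →L[ℝ] F} {u₀ : E}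
    (hs : HasFDerivAt s s' u₀) (hs0 : s u₀ = 0) (v : E)
    (hb : ContinuousAt (fun z : E × F => b z.1 z.2) (u₀, s' v))
    (hsmul : ∀ u (r : ℝ) η, b u (r • η) = r • b u η) :
    HasDerivAt (fun t : ℝ => b (u₀ + t • v) (s (u₀ + t • v))) (b u₀ (s' v)) 0 := by
  have hl : HasDerivAt (fun t : ℝ => u₀ + t • v) v 0 := by
    simpa using ((hasDerivAt_id (0 : ℝ)).smul_const v).const_add u₀
  have h1 : HasDerivAt (fun t : ℝ => s (u₀ + t • v)) (s' v) 0 := by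
    have hs' : HasFDerivAt s s' (u₀ + (0 : ℝ) • v) := by simpa using hs
    exact hs'.comp_hasDerivAt 0 hl
  have hb0 : b u₀ 0 = 0 := by simpa using hsmul u₀ 0 0
  rw [hasDerivAt_iff_tendsto_slope_zero] at h1 ⊢
  have h2 : Filter.Tendsto (fun t : ℝ => u₀ + t • v) (𝓝[≠] 0) (𝓝 u₀) := by
    have := hl.continuousAt.tendsto
    simp only [zero_smul, add_zero] at this
    exact this.mono_left nhdsWithin_le_nhds
  -- As `s u₀ = 0`, homogeneity turns the difference quotient into `b` evaluated at `t⁻¹ • s (u₀ + t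
  -- • v)`, so continuity of `b` suffices.
  have h3 := hb.tendsto.comp (h2.prodMk_nhds h1)
  refine h3.congr fun t => ?_
  simp [hs0, hb0, hsmul]

/-- The derivative along a line of the values at a fixed vector. -/
theorem hasDerivAt_line_apply {E : Type*} [NormedAddCommGroup E] [NormedSpace ℝ E]
    {G : E → E →L[ℝ] ℝ} {H : E →L[ℝ] E →L[ℝ] ℝ} {u₀ : E} (h : HasFDerivAt G H u₀) (v w : E) :
    HasDerivAt (fun t : ℝ => G (u₀ + t • v) w) (H v w) 0 := by
  have hl : HasDerivAt (fun t : ℝ => u₀ + t • v) v 0 := by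
    simpa using ((hasDerivAt_id (0 : ℝ)).smul_const v).const_add u₀
  have h' : HasFDerivAt G H (u₀ + (0 : ℝ) • v) := by simpa using h
  have h1 : HasDerivAt (fun t : ℝ => G (u₀ + t • v)) (H v) 0 := h'.comp_hasDerivAt 0 hl
  simpa using h1.clm_apply (hasDerivAt_const 0 w)

section Coordinates

variable {EΛ : Type*} [NormedAddCommGroup EΛ] [NormedSpace ℝ EΛ]
  {Λ : Type*} [TopologicalSpace Λ] [ChartedSpace EΛ Λ]
  {E : Type*} [NormedAddCommGroup E] [NormedSpace ℝ E]
  {X : Type*} [TopologicalSpace X] [ChartedSpace E X] [IsManifold 𝓘(ℝ, E) ∞ X]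
  {f : Λ → X → ℝ} {k : ℕ}
  {F : Type*} [NormedAddCommGroup F] [NormedSpace ℝ F]
  {V : X → Type*} [∀ x, AddCommGroup (V x)] [∀ x, Module ℝ (V x)] [∀ x, TopologicalSpace (V x)]
  [TopologicalSpace (TotalSpace F V)] [FiberBundle F V] [VectorBundle ℝ F V]
  [ContMDiffVectorBundle ∞ F V 𝓘(ℝ, E)]

/-- The points of the chart at `x₀` over which `V` is trivialized by the trivialization at `x₀`. -/
def bundleChartDomain (F : Type*) [NormedAddCommGroup F] [NormedSpace ℝ F]
    (V : X → Type*) [∀ x, TopologicalSpace (V x)]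
    [TopologicalSpace (TotalSpace F V)] [FiberBundle F V] (x₀ : X) : Set E :=
  (chartAt E x₀).target ∩ (chartAt E x₀).symm ⁻¹' (trivializationAt F V x₀).baseSet

omit [NormedSpace ℝ E] [IsManifold 𝓘(ℝ, E) ∞ X] [∀ x, AddCommGroup (V x)] [∀ x, Module ℝ (V x)]
  [VectorBundle ℝ F V] [ContMDiffVectorBundle ∞ F V 𝓘(ℝ, E)] in
theorem isOpen_bundleChartDomain (x₀ : X) :
    IsOpen (bundleChartDomain (E := E) F V x₀) :=
  (chartAt E x₀).symm.isOpen_inter_preimage (trivializationAt F V x₀).open_baseSet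

omit [NormedSpace ℝ E] [IsManifold 𝓘(ℝ, E) ∞ X] [∀ x, AddCommGroup (V x)]
  [∀ x, Module ℝ (V x)] [VectorBundle ℝ F V] [ContMDiffVectorBundle ∞ F V 𝓘(ℝ, E)] in
theorem mem_bundleChartDomain (x₀ : X) :
    chartAt E x₀ x₀ ∈ bundleChartDomain (E := E) F V x₀ := by
  refine ⟨mem_chart_target E x₀, ?_⟩
  rw [mem_preimage, (chartAt E x₀).left_inv (mem_chart_source E x₀)]
  exact FiberBundle.mem_baseSet_trivializationAt' x₀

/-- The derivative of a function in a chart, through the trivialization of the tangent bundle. -/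
theorem hasFDerivAt_comp_chart {h : X → ℝ} (hh : MDifferentiable 𝓘(ℝ, E) 𝓘(ℝ) h) {x₀ : X} {u : E}
    (hu : u ∈ (chartAt E x₀).target) :
    ∃ T : E →L[ℝ] ℝ, HasFDerivAt (h ∘ (chartAt E x₀).symm) T u ∧
      ∀ w : E, T w = mfderiv 𝓘(ℝ, E) 𝓘(ℝ) h ((chartAt E x₀).symm u)
        ((trivializationAt E (TangentSpace 𝓘(ℝ, E) : X → Type _) x₀).symmL ℝ
          ((chartAt E x₀).symm u) w) := by
  have h1 := TangentBundle.symmL_trivializationAt (I := 𝓘(ℝ, E)) ((chartAt E x₀).map_target hu)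
  have h2 : extChartAt 𝓘(ℝ, E) x₀ ((chartAt E x₀).symm u) = u := (chartAt E x₀).right_inv hu
  rw [h2] at h1
  have h3 : MDifferentiableWithinAt 𝓘(ℝ, E) 𝓘(ℝ, E) (extChartAt 𝓘(ℝ, E) x₀).symm
      (range 𝓘(ℝ, E)) u :=
    mdifferentiableWithinAt_extChartAt_symm (by simpa using hu)
  have h4 : HasMFDerivAt 𝓘(ℝ, E) 𝓘(ℝ, E) (chartAt E x₀).symm u
      ((trivializationAt E (TangentSpace 𝓘(ℝ, E) : X → Type _) x₀).symmL ℝ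
          ((chartAt E x₀).symm u) : E →L[ℝ] E) := by
    rw [h1]
    exact h3.hasMFDerivWithinAt.hasMFDerivAt (by simp)
  have h5 := HasMFDerivAt.comp u (hh ((chartAt E x₀).symm u)).hasMFDerivAt h4
  exact ⟨_, hasMFDerivAt_iff_hasFDerivAt.mp h5, fun w => rfl⟩

namespace AuxiliaryStructure

variable (S : AuxiliaryStructure k EΛ E f F V)

/-- The gradient in a chart of `Λ`, the chart at `x₀` and the trivialization of `V` at `x₀`. -/
noncomputable def localGrad (c : OpenPartialHomeomorph Λ EΛ) (x₀ : X) (z : EΛ × E) : F :=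
  (trivializationAt F V x₀).continuousLinearMapAt ℝ ((chartAt E x₀).symm z.2)
    (S.grad (c.symm z.1) ((chartAt E x₀).symm z.2))

/-- The pairing in the chart at `x₀` and the trivializations of `V` and `TX` at `x₀`. -/
noncomputable def localPairing (x₀ : X) (u : E) (η : F) (w : E) : ℝ :=
  S.inner ((chartAt E x₀).symm u)
    ((trivializationAt F V x₀).symmL ℝ ((chartAt E x₀).symm u) η)
    (S.incl ((chartAt E x₀).symm u)
      ((trivializationAt E (TangentSpace 𝓘(ℝ, E) : X → Type _) x₀).symmL ℝ
        ((chartAt E x₀).symm u) w))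

/-- The fibrewise product has the topology induced from the product of the two total spaces, so each
trivialization can be inverted separately before applying `continuous_pairing`. -/
theorem continuousOn_localPairing (x₀ : X) :
    ContinuousOn (fun z : E × F × E => S.localPairing x₀ z.1 z.2.1 z.2.2)
      {z | z.1 ∈ bundleChartDomain F V x₀} := by
  set e := trivializationAt F V x₀
  set τ := trivializationAt E (TangentSpace 𝓘(ℝ, E) : X → Type _) x₀
  set ψ := (chartAt E x₀).symm
  have hψ : ContinuousOn (fun z : E × F × E => ψ z.1) {z | z.1 ∈ bundleChartDomain F V x₀} :=
    (chartAt E x₀).continuousOn_symm.comp continuousOn_fst fun z hz => hz.1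
  have hτ : ∀ z : E × F × E, z.1 ∈ bundleChartDomain F V x₀ → ψ z.1 ∈ τ.baseSet := fun z hz =>
    (chartAt E x₀).map_target hz.1
  have h1 : ContinuousOn (fun z : E × F × E =>
      (⟨ψ z.1, (e.symmL ℝ (ψ z.1) z.2.1, τ.symmL ℝ (ψ z.1) z.2.2)⟩ :
        TotalSpace (F × E) (V ×ᵇ (TangentSpace 𝓘(ℝ, E) : X → Type _))))
      {z | z.1 ∈ bundleChartDomain F V x₀} := by
    rw [(FiberBundle.Prod.isInducing_diag F V E
      (TangentSpace 𝓘(ℝ, E) : X → Type _)).continuousOn_iff]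
    refine ContinuousOn.prodMk ?_ ?_
    · refine (e.continuousOn_symm.comp (f := fun z : E × F × E => (ψ z.1, z.2.1))
        (hψ.prodMk (by fun_prop)) fun z hz => ⟨hz.2, mem_univ _⟩).congr fun z hz => ?_
      simp only [Function.comp]
      rw [e.symmL_apply hz.2]
    · refine (τ.continuousOn_symm.comp (f := fun z : E × F × E => (ψ z.1, z.2.2))
        (hψ.prodMk (by fun_prop)) fun z hz => ⟨hτ z hz, mem_univ _⟩).congr fun z hz => ?_
      simp only [Function.comp]
      rw [τ.symmL_apply (hτ z hz)]
  exact S.continuous_pairing.comp_continuousOn h1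

theorem localGrad_eq_zero_iff {c : OpenPartialHomeomorph Λ EΛ} {x₀ : X} {z : EΛ × E}
    (hz : z.2 ∈ bundleChartDomain F V x₀) :
    S.localGrad c x₀ z = 0 ↔ IsCritical E (f (c.symm z.1)) ((chartAt E x₀).symm z.2) := by
  rw [S.isCritical_iff, localGrad]
  refine ⟨fun h => ?_, fun h => by rw [h, map_zero]⟩
  rw [← (trivializationAt F V x₀).symmL_continuousLinearMapAt (R := ℝ) hz.2
    (S.grad (c.symm z.1) ((chartAt E x₀).symm z.2)), h, map_zero]

theorem contDiffAt_localGrad [IsManifold 𝓘(ℝ, EΛ) ∞ Λ] {c : OpenPartialHomeomorph Λ EΛ}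
    (hc : c ∈ IsManifold.maximalAtlas 𝓘(ℝ, EΛ) ∞ Λ) {l₀ : Λ} (hl₀ : l₀ ∈ c.source) (x₀ : X) :
    ContDiffAt ℝ k (S.localGrad c x₀) (c l₀, chartAt E x₀ x₀) := by
  set ψ := (chartAt E x₀).symm with hψ
  have hψ0 : ψ (chartAt E x₀ x₀) = x₀ := (chartAt E x₀).left_inv (mem_chart_source E x₀)
  have h1 := (contMDiffAt_totalSpace.mp (S.contMDiff_grad (l₀, x₀))).2
  have h2 : ContMDiffAt 𝓘(ℝ, EΛ × E) 𝓘(ℝ, EΛ) k (fun z : EΛ × E => c.symm z.1)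
      (c l₀, chartAt E x₀ x₀) := by
    have h : ContMDiffAt 𝓘(ℝ, EΛ) 𝓘(ℝ, EΛ) k c.symm (c l₀) :=
      (contMDiffAt_symm_of_mem_maximalAtlas hc (c.map_source hl₀)).of_le
        (by exact_mod_cast le_top)
    exact h.comp (f := fun z : EΛ × E => z.1) (c l₀, chartAt E x₀ x₀)
      (contDiff_fst.contMDiff.contMDiffAt)
  have h3 : ContMDiffAt 𝓘(ℝ, EΛ × E) 𝓘(ℝ, E) k (fun z : EΛ × E => ψ z.2)
      (c l₀, chartAt E x₀ x₀) := by
    have h : ContMDiffAt 𝓘(ℝ, E) 𝓘(ℝ, E) k ψ (chartAt E x₀ x₀) :=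
      (contMDiffAt_symm_of_mem_maximalAtlas (I := 𝓘(ℝ, E)) (n := ∞)
        (IsManifold.chart_mem_maximalAtlas x₀) (mem_chart_target E x₀)).of_le
        (by exact_mod_cast le_top)
    exact h.comp (f := fun z : EΛ × E => z.2) (c l₀, chartAt E x₀ x₀)
      (contDiff_snd.contMDiff.contMDiffAt)
  have h4 := h2.prodMk h3
  have h5 : ContMDiffAt 𝓘(ℝ, EΛ × E) 𝓘(ℝ, F) k (fun z : EΛ × E => (trivializationAt F V x₀
      ⟨ψ z.2, S.grad (c.symm z.1) (ψ z.2)⟩).2) (c l₀, chartAt E x₀ x₀) :=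
    ContMDiffAt.comp_of_eq (f := fun z : EΛ × E => (c.symm z.1, ψ z.2)) h1 h4
      (by simp only [hψ0, c.left_inv hl₀])
  rw [contMDiffAt_iff_contDiffAt] at h5
  refine h5.congr_of_eventuallyEq ?_
  have h6 : ∀ᶠ z : EΛ × E in 𝓝 (c l₀, chartAt E x₀ x₀), z.2 ∈ bundleChartDomain F V x₀ :=
    continuousAt_snd ((isOpen_bundleChartDomain x₀).mem_nhds (mem_bundleChartDomain x₀))
  filter_upwards [h6] with z hz
  exact (trivializationAt F V x₀).continuousLinearMapAt_apply_of_mem ℝ hz.2 _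

theorem fderiv_eq_localPairing {c : OpenPartialHomeomorph Λ EΛ} {x₀ : X} {a : EΛ} {u : E}
    (hf : MDifferentiable 𝓘(ℝ, E) 𝓘(ℝ) (f (c.symm a)))
    (hu : u ∈ bundleChartDomain F V x₀) (w : E) :
    fderiv ℝ (f (c.symm a) ∘ (chartAt E x₀).symm) u w =
      S.localPairing x₀ u (S.localGrad c x₀ (a, u)) w := by
  obtain ⟨T, hT, hTw⟩ := hasFDerivAt_comp_chart hf hu.1
  rw [hT.fderiv, hTw]
  unfold localPairing localGrad
  rw [(trivializationAt F V x₀).symmL_continuousLinearMapAt (R := ℝ) hu.2, ← S.mfderiv_eq]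

theorem localPairing_smul_left (x₀ : X) (u : E) (r : ℝ) (η : F) (w : E) :
    S.localPairing x₀ u (r • η) w = r • S.localPairing x₀ u η w := by
  simp [localPairing]

theorem localPairing_smul_right (x₀ : X) (u : E) (r : ℝ) (η : F) (w : E) :
    S.localPairing x₀ u η (r • w) = r • S.localPairing x₀ u η w := by
  simp [localPairing]

/-- At `x₀` the tangent trivialization is the identity and that of `V` cancels against its inverse.
-/
theorem localPairing_base (x₀ : X) (e : V x₀) (w : E) :
    S.localPairing x₀ (chartAt E x₀ x₀)
      ((trivializationAt F V x₀).continuousLinearMapAt ℝ x₀ e) w = S.inner x₀ e (S.incl x₀ w) := by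
  have h1 : (chartAt E x₀).symm (chartAt E x₀ x₀) = x₀ :=
    (chartAt E x₀).left_inv (mem_chart_source E x₀)
  have h2 : (trivializationAt E (TangentSpace 𝓘(ℝ, E) : X → Type _) x₀).symmL ℝ x₀ w = w := by
    rw [TangentBundle.symmL_trivializationAt (mem_chart_source E x₀),
      mfderivWithin_range_extChartAt_symm]
    rfl
  have h3 : ∀ y, y = x₀ → S.inner y ((trivializationAt F V x₀).symmL ℝ y
      ((trivializationAt F V x₀).continuousLinearMapAt ℝ x₀ e)) (S.incl y
        ((trivializationAt E (TangentSpace 𝓘(ℝ, E) : X → Type _) x₀).symmL ℝ y w)) =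
      S.inner x₀ e (S.incl x₀ w) := by
    intro y hy
    subst hy
    rw [h2, (trivializationAt F V y).symmL_continuousLinearMapAt (R := ℝ)
      (FiberBundle.mem_baseSet_trivializationAt' y)]
  exact h3 _ h1

/-- The Hessian at a critical point through the derivative of the gradient. -/
theorem hessian_eq_localPairing [IsManifold 𝓘(ℝ, EΛ) ∞ Λ] {c : OpenPartialHomeomorph Λ EΛ}
    {l₀ : Λ} (hl₀ : l₀ ∈ c.source) {x₀ : X} (hf : ContMDiff 𝓘(ℝ, E) 𝓘(ℝ) 2 (f l₀))
    (hcrit : IsCritical E (f l₀) x₀) {σ' : E →L[ℝ] F}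
    (hσ : HasFDerivAt (fun u => S.localGrad c x₀ (c l₀, u)) σ' (chartAt E x₀ x₀)) (v w : E) :
    hessian (E := E) (f l₀) x₀ v w = S.localPairing x₀ (chartAt E x₀ x₀) (σ' v) w := by
  set u₀ := chartAt E x₀ x₀ with hu₀
  have hu₀d : u₀ ∈ bundleChartDomain (E := E) F V x₀ := mem_bundleChartDomain x₀
  have hl : c.symm (c l₀) = l₀ := c.left_inv hl₀
  have hψ0 : (chartAt E x₀).symm u₀ = x₀ := (chartAt E x₀).left_inv (mem_chart_source E x₀)
  have h0 : S.localGrad c x₀ (c l₀, u₀) = 0 := by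
    rw [S.localGrad_eq_zero_iff hu₀d]
    simp only [hl, hψ0]
    exact hcrit
  have hpair : ContinuousAt (fun z : E × F => S.localPairing x₀ z.1 z.2 w) (u₀, σ' v) := by
    have hopen : IsOpen {z : E × F × E | z.1 ∈ bundleChartDomain F V x₀} :=
      (isOpen_bundleChartDomain x₀).preimage continuous_fst
    exact ContinuousAt.comp (f := fun z : E × F => (z.1, z.2, w))
      ((S.continuousOn_localPairing x₀).continuousAt
        (hopen.mem_nhds (x := (u₀, σ' v, w)) hu₀d)) (by fun_prop)
  -- The pairing need not be differentiable in the base point. Criticality makes the gradient vanish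
  -- at `u₀`, so only the derivative of the gradient contributes.
  have h1 := hasDerivAt_pairing_of_zero (b := fun u η => S.localPairing x₀ u η w) hσ h0 v hpair
    fun u r η => S.localPairing_smul_left x₀ u r η w
  have h2 : HasFDerivAt (fderiv ℝ (f l₀ ∘ (chartAt E x₀).symm))
      (hessian (E := E) (f l₀) x₀ : E →L[ℝ] E →L[ℝ] ℝ) u₀ := by
    have h3 : ContDiffAt ℝ 2 (f l₀ ∘ (chartAt E x₀).symm) u₀ := by
      rw [← contMDiffAt_iff_contDiffAt]
      refine (hf _).comp u₀ ?_
      exact (contMDiffAt_symm_of_mem_maximalAtlas (I := 𝓘(ℝ, E)) (n := ∞)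
        (IsManifold.chart_mem_maximalAtlas x₀) (mem_chart_target E x₀)).of_le
        (WithTop.coe_le_coe.mpr (le_top : (2 : ℕ∞) ≤ ⊤))
    exact ((h3.fderiv_right (m := 1) (by norm_num)).differentiableAt (by simp)).hasFDerivAt
  have h4 : HasDerivAt (fun t : ℝ => fderiv ℝ (f l₀ ∘ (chartAt E x₀).symm) (u₀ + t • v) w)
      (hessian (E := E) (f l₀) x₀ v w) 0 := by
    exact hasDerivAt_line_apply h2 v w
  refine h4.unique (h1.congr_of_eventuallyEq ?_)
  have h5 : ∀ᶠ t : ℝ in 𝓝 0, u₀ + t • v ∈ bundleChartDomain (E := E) F V x₀ := by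
    have : ContinuousAt (fun t : ℝ => u₀ + t • v) 0 := by fun_prop
    exact this (by simpa using (isOpen_bundleChartDomain x₀).mem_nhds hu₀d)
  filter_upwards [h5] with t ht
  have hmd : MDifferentiable 𝓘(ℝ, E) 𝓘(ℝ) (f (c.symm (c l₀))) := by
    rw [hl]
    exact hf.mdifferentiable (by simp)
  have := S.fderiv_eq_localPairing hmd ht w
  rwa [hl] at this

end AuxiliaryStructure

/-- The Hessian of a `C^2` function is symmetric. -/
theorem hessian_symm {h : X → ℝ} (hh : ContMDiff 𝓘(ℝ, E) 𝓘(ℝ) 2 h) (x : X)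
    (v w : TangentSpace 𝓘(ℝ, E) x) : hessian (E := E) h x v w = hessian (E := E) h x w v := by
  have h3 : ContDiffAt ℝ 2 (h ∘ (chartAt E x).symm) (chartAt E x x) := by
    rw [← contMDiffAt_iff_contDiffAt]
    refine (hh _).comp _ ?_
    exact (contMDiffAt_symm_of_mem_maximalAtlas (I := 𝓘(ℝ, E)) (n := ∞)
      (IsManifold.chart_mem_maximalAtlas x) (mem_chart_target E x)).of_le
      (WithTop.coe_le_coe.mpr (le_top : (2 : ℕ∞) ≤ ⊤))
  exact h3.isSymmSndFDerivAt (by simp) v w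

end Coordinates

/-! ### Invariance -/

section Invariance

variable {EΛ : Type*} [NormedAddCommGroup EΛ] [NormedSpace ℝ EΛ]
  {Λ : Type*} [TopologicalSpace Λ] [ChartedSpace EΛ Λ]
  {EG : Type*} [NormedAddCommGroup EG] [NormedSpace ℝ EG]
  {𝒢 : Type*} [TopologicalSpace 𝒢] [ChartedSpace EG 𝒢]
  {E : Type*} [NormedAddCommGroup E] [NormedSpace ℝ E]
  {X : Type*} [TopologicalSpace X] [ChartedSpace E X] {B : LieGroupBundle EΛ Λ EG 𝒢}
  {A : Action B E X}

theorem Action.act_inv_act (A : Action B E X) (p : 𝒢) (x : X) :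
    A.act (B.inv p) (A.act p x) = x := by
  rw [← A.mul_act _ _ _ (B.proj_inv p), B.inv_mul, A.one_act]

theorem Action.mem_orbit_act (A : Action B E X) {l : Λ} {p : 𝒢} (hp : p ∈ B.fiber l) (x : X) :
    x ∈ A.orbit l (A.act p x) :=
  ⟨B.inv p, (B.proj_inv p).trans hp, A.act_inv_act p x⟩

/-- Group elements map critical points of an invariant family to critical points. -/
theorem Action.Invariant.isCritical_act {f : Λ → X → ℝ} (hinv : A.Invariant f) {l : Λ}
    (hf : MDifferentiable 𝓘(ℝ, E) 𝓘(ℝ) (f l)) {p : 𝒢} (hp : p ∈ B.fiber l) {x : X}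
    (hx : IsCritical E (f l) x) : IsCritical E (f l) (A.act p x) := by
  have h1 : f l = f l ∘ A.act (B.inv p) := funext fun y =>
    (hinv l _ ((B.proj_inv p).trans hp) y).symm
  have h2 : HasMFDerivAt 𝓘(ℝ, E) 𝓘(ℝ) (f l ∘ A.act (B.inv p)) (A.act p x)
      ((mfderiv 𝓘(ℝ, E) 𝓘(ℝ) (f l) (A.act (B.inv p) (A.act p x))).comp
        (mfderiv 𝓘(ℝ, E) 𝓘(ℝ, E) (A.act (B.inv p)) (A.act p x))) :=
    HasMFDerivAt.comp (A.act p x) (hf _).hasMFDerivAt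
      ((A.contMDiff_act (B.inv p)).mdifferentiable (by simp) _).hasMFDerivAt
  rw [← h1] at h2
  have h3 : ∀ y, y = x → mfderiv 𝓘(ℝ, E) 𝓘(ℝ) (f l) y = 0 := by
    rintro y rfl
    exact hx
  unfold IsCritical
  rw [h2.mfderiv, h3 _ (A.act_inv_act p x)]
  exact ContinuousLinearMap.zero_comp _

variable [IsManifold 𝓘(ℝ, EG) ∞ 𝒢] [IsManifold 𝓘(ℝ, E) ∞ X]
  {D : Type*} [NormedAddCommGroup D] [NormedSpace ℝ D]
  {c : OpenPartialHomeomorph Λ EΛ} {N : Set (EΛ × D)} {g : EΛ → D → 𝒢}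

/-- The differential of an invariant function vanishes along the velocities of the action. -/
theorem LocalFamily.fderiv_chartVelocity (h : LocalFamily B c N g) (hA : A.IsRegular)
    {f : Λ → X → ℝ} (hinv : A.Invariant f) {a : EΛ}
    (hf : MDifferentiable 𝓘(ℝ, E) 𝓘(ℝ) (f (c.symm a))) (ha : (a, (0 : D)) ∈ N) {x₀ : X} {u : E}
    (hu : u ∈ (chartAt E x₀).target) (κ : D) :
    fderiv ℝ (f (c.symm a) ∘ (chartAt E x₀).symm) u (A.chartVelocity c N g x₀ (a, 0, u) κ) = 0 := by
  set x := (chartAt E x₀).symm u with hx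
  have hxs : x ∈ (chartAt E x₀).source := (chartAt E x₀).map_target hu
  have hact : A.act (g a 0) x = x := by rw [h.zero_eq a ha, A.one_act]
  have hφ : chartAt E x₀ x = u := (chartAt E x₀).right_inv hu
  have h1 := h.hasFDerivAt_act hA (x₀ := x₀) ha (x := x) (by rwa [hact])
  obtain ⟨T, hT, -⟩ := hasFDerivAt_comp_chart hf hu
  rw [hact, hφ] at h1
  have hT' : HasFDerivAt (f (c.symm a) ∘ (chartAt E x₀).symm) T
      (chartAt E x₀ (A.act (g a 0) x)) := by
    rwa [hact, hφ]
  have h2 := hT'.comp (0 : D) h1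
  have h3 : HasFDerivAt (fun _ : D => f (c.symm a) x) (0 : D →L[ℝ] ℝ) 0 := hasFDerivAt_const _ _
  -- By invariance the function is constant along the curve, whose derivative at `0` is the chart
  -- velocity.
  have h4 : (fun _ : D => f (c.symm a) x) =ᶠ[𝓝 0] ((f (c.symm a) ∘ (chartAt E x₀).symm) ∘
      fun w' => chartAt E x₀ (A.act (g a w') x)) := by
    have hcont := h.continuousAt_act hA ha x
    have hev : ∀ᶠ w' in 𝓝 (0 : D), A.act (g a w') x ∈ (chartAt E x₀).source :=
      hcont ((chartAt E x₀).open_source.mem_nhds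
        (show A.act (g a 0) x ∈ (chartAt E x₀).source by rwa [hact]))
    filter_upwards [hev, h.eventually_mem ha] with w' hw' hN
    simp only [Function.comp]
    rw [(chartAt E x₀).left_inv hw', hinv _ _ (h.proj_eq _ hN)]
  have h5 := (h2.congr_of_eventuallyEq h4).unique h3
  rw [hT.fderiv]
  exact congrArg (fun L : D →L[ℝ] ℝ => L κ) h5

end Invariance

/-- A linear map whose range contains a finite-dimensional subspace has a continuous section over
it. -/
theorem exists_clm_section {D E : Type*} [NormedAddCommGroup D] [NormedSpace ℝ D]
    [NormedAddCommGroup E] [NormedSpace ℝ E] (T : D →L[ℝ] E) (K : Submodule ℝ E)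
    [FiniteDimensional ℝ K] (hK : ∀ κ ∈ K, ∃ w, T w = κ) :
    ∃ L : K →L[ℝ] D, ∀ κ, T (L κ) = κ := by
  have hle : K ≤ LinearMap.range T.toLinearMap := fun κ hκ => hK κ hκ
  obtain ⟨s, hs⟩ := T.toLinearMap.rangeRestrict.exists_rightInverse_of_surjective
    T.toLinearMap.range_rangeRestrict
  refine ⟨LinearMap.toContinuousLinearMap (s ∘ₗ Submodule.inclusion hle), fun κ => ?_⟩
  have := congrArg Subtype.val (LinearMap.congr_fun hs (Submodule.inclusion hle κ))
  exact this

end EquivariantIFT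

/-! ### The slice, the implicit function and the group action combined -/

open EquivariantIFT

theorem mainTheorem1
    -- the parameter manifold, of finite dimension
    {EΛ : Type*} [NormedAddCommGroup EΛ] [NormedSpace ℝ EΛ] [FiniteDimensional ℝ EΛ]
    {Λ : Type*} [TopologicalSpace Λ] [ChartedSpace EΛ Λ] [IsManifold 𝓘(ℝ, EΛ) ∞ Λ]
    -- the total space of the bundle of (finite-dimensional) Lie groups
    {EG : Type*} [NormedAddCommGroup EG] [NormedSpace ℝ EG] [FiniteDimensional ℝ EG]
    {𝒢 : Type*} [TopologicalSpace 𝒢] [ChartedSpace EG 𝒢] [IsManifold 𝓘(ℝ, EG) ∞ 𝒢]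
    (B : EquivariantIFT.LieGroupBundle EΛ Λ EG 𝒢)
    -- the Banach manifold `X` and the regular action
    {E : Type*} [NormedAddCommGroup E] [NormedSpace ℝ E] [CompleteSpace E]
    {X : Type*} [TopologicalSpace X] [T2Space X] [ChartedSpace E X] [IsManifold 𝓘(ℝ, E) ∞ X]
    (A : EquivariantIFT.Action B E X) (hA : A.IsRegular)
    -- the invariant family of functionals
    (k : ℕ) (hk : 1 ≤ k) (f : Λ → X → ℝ)
    (hf : ∀ l, ContMDiff 𝓘(ℝ, E) 𝓘(ℝ) (k + 1) (f l)) (hinv : A.Invariant f)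
    -- the auxiliary Fredholm structure
    {F : Type*} [NormedAddCommGroup F] [NormedSpace ℝ F] [CompleteSpace F]
    {V : X → Type*} [∀ x, AddCommGroup (V x)] [∀ x, Module ℝ (V x)] [∀ x, TopologicalSpace (V x)]
    [TopologicalSpace (TotalSpace F V)] [FiberBundle F V] [VectorBundle ℝ F V]
    [ContMDiffVectorBundle ∞ F V 𝓘(ℝ, E)]
    (S : EquivariantIFT.AuxiliaryStructure k EΛ E f F V)
    -- the equivariantly nondegenerate critical point
    (l₀ : Λ) (x₀ : X) (hx₀ : A.EquivariantlyNondegenerate f l₀ x₀)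
    (hJ : S.HessianIsFredholm l₀ x₀) :
    ∃ U : Set Λ, IsOpen U ∧ l₀ ∈ U ∧ ∃ W : Set X, IsOpen W ∧ x₀ ∈ W ∧
      ∃ ξ : Λ → X, MapsTo ξ U W ∧
        ∀ l ∈ U, ∀ x ∈ W, EquivariantIFT.IsCritical E (f l) x ↔ x ∈ A.orbit l (ξ l) := by
  have hf2 : ∀ l, ContMDiff 𝓘(ℝ, E) 𝓘(ℝ) 2 (f l) := fun l => (hf l).of_le (by
    have : (2 : ℕ) ≤ k + 1 := by omega
    exact_mod_cast this)
  have hfd : ∀ l, MDifferentiable 𝓘(ℝ, E) 𝓘(ℝ) (f l) := fun l =>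
    (hf2 l).mdifferentiable (by simp)
  obtain ⟨hcrit, hker⟩ := hx₀
  obtain ⟨J, hJF, hind, hJh⟩ := hJ
  obtain ⟨D, _, _, _, c, N, g, hl₀, hc, h0N, hfam, hvel⟩ := B.exists_localFamily l₀
  set e := trivializationAt F V x₀ with he
  have hx₀e : x₀ ∈ e.baseSet := FiberBundle.mem_baseSet_trivializationAt' x₀
  set a₀ : EΛ := c l₀ with ha₀
  set u₀ : E := chartAt E x₀ x₀ with hu₀
  have hca₀ : c.symm a₀ = l₀ := c.left_inv hl₀
  have hψu₀ : (chartAt E x₀).symm u₀ = x₀ := (chartAt E x₀).left_inv (mem_chart_source E x₀)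
  -- the Fredholm operator
  have hfk : FiniteDimensional ℝ (LinearMap.ker J.toLinearMap) := hJF.finite_ker
  have hfc : FiniteDimensional ℝ (V x₀ ⧸ LinearMap.range J.toLinearMap) := hJF.finite_coker
  obtain ⟨hcompl, hperp⟩ := isCompl_range_of_symmetric (J := J.toLinearMap)
    (i := (S.incl x₀).toLinearMap) (b := S.inner x₀) (S.incl_injective x₀) (S.inner_pos x₀)
    (fun v w => by
      have h := hessian_symm (hf2 l₀) x₀ v w
      rw [hJh, hJh] at h
      exact h) hind
  let K : Submodule ℝ E := LinearMap.ker J.toLinearMap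
  have hfK : FiniteDimensional ℝ K := hfk
  have hKhess : ∀ κ ∈ K, κ ∈ A.orbitTangent l₀ x₀ := fun κ hκ => hker (by
    have hκ' : J κ = 0 := hκ
    refine LinearMap.mem_ker.mpr (ContinuousLinearMap.ext fun w => ?_)
    refine (hJh κ w).trans ?_
    rw [hκ', map_zero]
    rfl)
  -- a family of group elements with velocities `K`
  obtain ⟨-, L, hL, -⟩ := hvel 0 (zero_mem _)
  obtain ⟨L', hL'⟩ := exists_clm_section (D := D) (E := E)
    ((A.orbitDeriv l₀ x₀ : EG →L[ℝ] E) ∘L L) K (by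
    intro κ hκ
    obtain ⟨v, hv, hvκ⟩ := hKhess κ hκ
    obtain ⟨w, L₁, hL₁, hw⟩ := hvel v hv
    have hLL : L₁ = L := hasMFDerivAt_unique hL₁ hL
    refine ⟨w, ?_⟩
    rw [hLL] at hw
    exact (congrArg (A.orbitDeriv l₀ x₀) hw).trans hvκ)
  have hfam' := hfam.comp_clm L'
  set N' : Set (EΛ × K) := (fun z : EΛ × K => (z.1, L' z.2)) ⁻¹' N with hN'
  set g' : EΛ → K → 𝒢 := fun a κ => g a (L' κ) with hg'
  have h0N' : (a₀, (0 : K)) ∈ N' := by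
    rw [hN', mem_preimage, map_zero]
    exact h0N
  have hLL' : HasMFDerivAt 𝓘(ℝ, K) 𝓘(ℝ, EG) (g' a₀) 0 (L ∘L L') := by
    have h1 : HasMFDerivAt 𝓘(ℝ, K) 𝓘(ℝ, D) L' (0 : K) L' := L'.hasMFDerivAt
    have h2 : HasMFDerivAt 𝓘(ℝ, D) 𝓘(ℝ, EG) (g a₀) (L' 0) L := by rwa [map_zero]
    exact HasMFDerivAt.comp (0 : K) h2 h1
  set Θ := A.chartVelocity c N' g' x₀ with hΘ
  have hΘ0 : ∀ κ : K, Θ (a₀, 0, u₀) κ = κ := by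
    intro κ
    rw [hΘ, hfam'.chartVelocity_base hA hl₀ h0N' hLL']
    exact hL' κ
  have hΘc : ContinuousAt Θ (a₀, 0, u₀) :=
    hfam'.continuousAt_chartVelocity hA h0N' (mem_chart_target E x₀)
  obtain ⟨P, hP⟩ := Submodule.ClosedComplemented.of_finiteDimensional K
  -- the gradient in coordinates
  set σ := S.localGrad c x₀ with hσ
  have hk' : (k : ℕ∞ω) ≠ 0 := by
    have : k ≠ 0 := by omega
    exact_mod_cast this
  have hσd : HasStrictFDerivAt σ (fderiv ℝ σ (a₀, u₀)) (a₀, u₀) :=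
    (S.contDiffAt_localGrad hc hl₀ x₀).hasStrictFDerivAt hk'
  set σ' := fderiv ℝ σ (a₀, u₀) with hσ'
  have hdom₀ : u₀ ∈ bundleChartDomain (E := E) F V x₀ := mem_bundleChartDomain x₀
  have hσ0 : σ (a₀, u₀) = 0 := by
    rw [hσ, S.localGrad_eq_zero_iff hdom₀]
    simp only [hca₀, hψu₀]
    exact hcrit
  have hσJ : ∀ v : E, σ' (0, v) = e.continuousLinearMapAt ℝ x₀ (J v) := by
    intro v
    have hpart : HasFDerivAt (fun u => σ (a₀, u)) (σ' ∘L ContinuousLinearMap.inr ℝ EΛ E) u₀ :=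
      hσd.hasFDerivAt.comp u₀ ((hasFDerivAt_const a₀ u₀).prodMk (hasFDerivAt_id u₀))
    -- Both vectors represent the Hessian, but only against tangent vectors. They agree because no
    -- nonzero vector of the fibre is orthogonal to the tangent space.
    have h1 : e.symmL ℝ x₀ (σ' (0, v)) - J v = 0 := by
      refine hperp _ fun w => ?_
      have h2 := S.hessian_eq_localPairing hl₀ (hf2 l₀) hcrit hpart v w
      have h3 := S.localPairing_base x₀ (e.symmL ℝ x₀ (σ' (0, v))) w
      rw [e.continuousLinearMapAt_symmL hx₀e] at h3
      have h4 := hJh v w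
      rw [map_sub, LinearMap.sub_apply, sub_eq_zero]
      exact h3.symm.trans (h2.symm.trans h4)
    rw [← sub_eq_zero.mp h1, e.continuousLinearMapAt_symmL hx₀e]
  let ι : K →L[ℝ] F := (e.continuousLinearMapAt ℝ x₀) ∘L (S.incl x₀) ∘L K.subtypeL
  have hbij : Function.Bijective fun v => σ' (0, v) + ι (P v) := by
    have h1 := bijective_add_projection (S.incl_injective x₀) hcompl (P := P.toLinearMap) hP
    have h2 := (e.continuousLinearEquivAt ℝ x₀ hx₀e).bijective.comp h1
    refine (congrArg Function.Bijective (funext fun v => ?_)).mpr h2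
    rw [hσJ]
    simp only [Function.comp]
    rw [e.coe_continuousLinearEquivAt_eq hx₀e]
    exact (map_add (e.continuousLinearMapAt ℝ x₀) _ _).symm
  -- near the base point, the gradient does not take nonzero values in the range of `ι`
  have hdomev : ∀ᶠ z : EΛ × E in 𝓝 (a₀, u₀), z.2 ∈ bundleChartDomain (E := E) F V x₀ :=
    continuousAt_snd ((isOpen_bundleChartDomain x₀).mem_nhds hdom₀)
  have hι : ∀ᶠ z in 𝓝 (a₀, u₀), ∀ κ, σ z = ι κ → κ = 0 := by
    -- At the base point `Θ κ = κ`, so this pairing is the square norm of `incl κ`. It stays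
    -- positive nearby, whereas invariance makes the pairing of `σ z` with `Θ κ` zero.
    have hpos : ∀ᶠ z : EΛ × E in 𝓝 (a₀, u₀), ∀ κ : K, κ ≠ 0 →
        0 < S.localPairing x₀ z.2 (ι κ) (Θ (z.1, 0, z.2) κ) := by
      refine eventually_pos_of_homogeneous
        (Y := EΛ × E) (y₀ := (a₀, u₀))
        (β := fun z κ => S.localPairing x₀ z.2 (ι κ) (Θ (z.1, 0, z.2) κ)) ?_ ?_ ?_
      · intro κ
        have hopen : IsOpen {z : E × F × E | z.1 ∈ bundleChartDomain F V x₀} :=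
          (isOpen_bundleChartDomain x₀).preimage continuous_fst
        have h1 : ContinuousAt (fun z : E × F × E => S.localPairing x₀ z.1 z.2.1 z.2.2)
            (u₀, ι κ, Θ (a₀, 0, u₀) κ) :=
          (S.continuousOn_localPairing x₀).continuousAt (hopen.mem_nhds hdom₀)
        have h2 : ContinuousAt (fun z : (EΛ × E) × K => Θ (z.1.1, 0, z.1.2)) ((a₀, u₀), κ) :=
          ContinuousAt.comp (f := fun z : (EΛ × E) × K => (z.1.1, (0 : K), z.1.2)) (g := Θ)
            (x := ((a₀, u₀), κ)) hΘc (by fun_prop)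
        have h3 : ContinuousAt (fun z : (EΛ × E) × K => Θ (z.1.1, 0, z.1.2) z.2)
            ((a₀, u₀), κ) := h2.clm_apply continuousAt_snd
        exact ContinuousAt.comp
          (f := fun z : (EΛ × E) × K => (z.1.2, ι z.2, Θ (z.1.1, 0, z.1.2) z.2))
          (g := fun z : E × F × E => S.localPairing x₀ z.1 z.2.1 z.2.2)
          (x := ((a₀, u₀), κ)) h1
          ((by fun_prop : ContinuousAt (fun z : (EΛ × E) × K => z.1.2) _).prodMk
            ((by fun_prop : ContinuousAt (fun z : (EΛ × E) × K => ι z.2) _).prodMk h3))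
      · intro z r κ
        rw [map_smul, map_smul, S.localPairing_smul_left, S.localPairing_smul_right, smul_eq_mul,
          smul_eq_mul]
        ring
      · intro κ hκ
        change 0 < S.localPairing x₀ u₀ (ι κ) (Θ (a₀, 0, u₀) κ)
        rw [hΘ0, show ι κ = e.continuousLinearMapAt ℝ x₀ (S.incl x₀ (κ : E)) from rfl,
          S.localPairing_base]
        refine S.inner_pos x₀ _ fun h0 => hκ ?_
        exact Subtype.ext (S.incl_injective x₀ (h0.trans (map_zero (S.incl x₀)).symm))
    have hN'ev : ∀ᶠ z : EΛ × E in 𝓝 (a₀, u₀), (z.1, (0 : K)) ∈ N' :=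
      (by fun_prop : ContinuousAt (fun z : EΛ × E => (z.1, (0 : K))) (a₀, u₀))
        (hfam'.isOpen.mem_nhds h0N')
    filter_upwards [hpos, hN'ev, hdomev] with z hz hzN hzd κ hκ
    by_contra hne
    have h1 := hz κ hne
    rw [← hκ, hσ, ← S.fderiv_eq_localPairing (hfd _) hzd,
      hfam'.fderiv_chartVelocity hA hinv (hfd _) hzN hzd.1] at h1
    exact lt_irrefl _ h1
  obtain ⟨ξ, hξt, hξ0, hξu⟩ := exists_zero_on_slice hσd hσ0 hbij hι
  -- moving points into the slice
  rw [nhds_prod_eq] at hξu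
  obtain ⟨A₁, hA₁, O₁, hO₁, hAO₁⟩ := Filter.mem_prod_iff.mp hξu
  have hslice := eventually_exists_mem_slice (chartAt E x₀) (T := EΛ) (D := K)
    (q := fun a w x => A.act (g' a w) x) (Θ := Θ) (a₀ := a₀) (u₀ := u₀) (mem_chart_target E x₀)
    hΘc (P := P) (by ext κ; simp [hΘ0, hP]) (hfam'.isOpen.mem_nhds h0N')
    (fun a x ha => by rw [hfam'.zero_eq a ha, A.one_act])
    (fun a w x hz => hfam'.continuousAt_act hA hz x)
    (fun a w x hz hx => hfam'.hasFDerivAt_act hA hz hx)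
    (O := O₁ ∩ bundleChartDomain F V x₀)
    (Filter.inter_mem hO₁ ((isOpen_bundleChartDomain x₀).mem_nhds hdom₀))
  rw [nhds_prod_eq] at hslice
  obtain ⟨A₂, hA₂, O₂, hO₂, hAO₂⟩ := Filter.mem_prod_iff.mp hslice
  -- `O₃` is the coordinate image of the neighbourhood of `x₀`. Then `A₃` is chosen so that the
  -- zeros `ξ a` also lie in `O₃`.
  obtain ⟨O₃, hO₃, hO₃o, hu₀O₃⟩ := mem_nhds_iff.mp
    (Filter.inter_mem hO₂ ((isOpen_bundleChartDomain x₀).mem_nhds hdom₀))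
  obtain ⟨A₃, hA₃, hA₃o, ha₀A₃⟩ := mem_nhds_iff.mp
    (Filter.inter_mem (Filter.inter_mem hA₁ hA₂)
      (Filter.inter_mem hξ0 (hξt (hO₃o.mem_nhds hu₀O₃))))
  have hcritξ : ∀ l ∈ c.source, c l ∈ A₃ → IsCritical E (f l) ((chartAt E x₀).symm (ξ (c l))) := by
    intro l hl hlA
    have h1 := (S.localGrad_eq_zero_iff (c := c) (x₀ := x₀) (z := (c l, ξ (c l)))
      (hO₃ (hA₃ hlA).2.2).2).mp (hA₃ hlA).2.1
    simpa only [c.left_inv hl] using h1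
  refine ⟨c.source ∩ c ⁻¹' A₃, c.isOpen_inter_preimage hA₃o, ⟨hl₀, ha₀A₃⟩,
    (chartAt E x₀).source ∩ (chartAt E x₀) ⁻¹' O₃, (chartAt E x₀).isOpen_inter_preimage hO₃o,
    ⟨mem_chart_source E x₀, hu₀O₃⟩, fun l => (chartAt E x₀).symm (ξ (c l)), ?_, ?_⟩
  · rintro l ⟨hl, hlA⟩
    have h1 : ξ (c l) ∈ O₃ := (hA₃ hlA).2.2
    have h2 : ξ (c l) ∈ (chartAt E x₀).target := (hO₃ h1).2.1
    exact ⟨(chartAt E x₀).map_target h2, by rwa [mem_preimage, (chartAt E x₀).right_inv h2]⟩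
  · rintro l ⟨hl, hlA⟩ x ⟨hxs, hxO⟩
    constructor
    · intro hx
      -- The group element moving `x` into the slice yields a critical point there, which can only
      -- be `ξ (c l)`; its inverse puts `x` in the orbit of that point.
      obtain ⟨w, hw, hys, hyO, hyP⟩ := hAO₂ (mk_mem_prod (hA₃ hlA).1.2 (hO₃ hxO).1)
      simp only [(chartAt E x₀).left_inv hxs] at hw hys hyO hyP
      have hfib : g' (c l) w ∈ B.fiber l := by
        have := hfam'.proj_eq _ hw
        rwa [c.left_inv hl] at this
      have hy := hinv.isCritical_act (hfd l) hfib hx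
      have hσy : σ (c l, chartAt E x₀ (A.act (g' (c l) w) x)) = 0 := by
        rw [hσ, S.localGrad_eq_zero_iff hyO.2]
        simpa only [c.left_inv hl, (chartAt E x₀).left_inv hys] using hy
      have heq : chartAt E x₀ (A.act (g' (c l) w) x) = ξ (c l) :=
        hAO₁ (mk_mem_prod (hA₃ hlA).1.1 hyO.1) hσy hyP
      simp only [← heq, (chartAt E x₀).left_inv hys]
      exact A.mem_orbit_act hfib x
    · rintro ⟨p, hp, rfl⟩
      exact hinv.isCritical_act (hfd l) hp (hcritξ l hl hlA)
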